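/- Let $k$ be a field. Let $\mathcal S=(\mathcal S,\mathcal M,\Gamma)$ be a marked ribbon surface: an oriented connected surface with non-empty boundary, a finite set $\mathcal M$ of marked points on $\partial\mathcal S$, and a finite non-empty system $\Gamma$ of arcs with ends in $\mathcal M$ which cuts $\mathcal S$ into polygons, each having exactly one side not in $\Gamma$ (a boundary segment or a whole boundary component without marked points). Let $A=kQ/I$ be its gentle algebra: the vertices of $Q$ are the arcs; there is an arrow $u\to v$ whenever $u,v$ are neighbouring sides of a polygon and $v$ follows $u$ counterclockwise about their common endpoint; $I$ is generated by the products of two successive arrows coming from three successive sides of one polygon. Modules are finitely generated right $A$-modules. A (non-trivial) permissible curve $c$ joins two points, each a marked point or the extra point on the boundary segment of a polygon with only one other side. It consecutively crosses arcs $\gamma_1,\dots,\gamma_n$ ($n\ge 1$), with a minimal number of crossings up to homotopy and with end segments of winding number $0$ or $1$ about unmarked boundary components; between $\gamma_i$ and $\gamma_{i+1}$ it cuts off a triangle of a polygon, with vertex a common endpoint $p(\gamma_i,\gamma_{i+1},c)\in\mathcal M$ of the two arcs. It defines a string, in which the $i$-th letter is the arrow $\gamma_i\to\gamma_{i+1}$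 if $p(\gamma_i,\gamma_{i+1},c)$ is on the left of $c$, and the inverse of the arrow $\gamma_{i+1}\to\gamma_i$ if it is on the right; $M(c)$ is the string module of this string. A permissible closed curve $c$ is defined in the same way, with indices modulo $n$, and together with an automorphism $\varphi$ of a finite-dimensional $k$-space $V$ (for instance a Jordan block) it defines the band module $M(c,\varphi)$. For an arc $\gamma$, a permissible curve as above is a projective permissible curve of $\gamma$, denoted $c^{\gamma}_{\mathrm{proj}}$, if for some $i$ we have $\gamma_i=\gamma$, the points $p(\gamma_1,\gamma_2,c)=\dots=p(\gamma_{i-1},\gamma_i,c)$ agree and are on the right of $c$, the points $p(\gamma_i,\gamma_{i+1},c)=\dots=p(\gamma_{n-1},\gamma_n,c)$ agree and are on the left of $c$, no arc precedes $\gamma_1$ clockwise about its endpoint on the right of $c$, and no arc follows $\gamma_n$ counterclockwise about its endpoint on the left of $c$. An injective permissible curve $c^{\gamma}_{\mathrm{inj}}$ is defined by exchanging left and right, and clockwise and counterclockwise. Then every arc $\gamma$ has a projective and an injective permissible curve, and for every choice of $c^{\gamma}_{\mathrm{proj}}$ and $c^{\gamma}_{\mathrm{inj}}$ ($\gamma\in\Gamma$)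 the following hold. (1) Let $c$ be a non-trivial permissible curve. Let $\mathfrak I$ be the set of all $i\in\{1,\dots,n\}$ such that $p(\gamma_{i-1},\gamma_i,c)$ is on the right of $c$ (no condition if $i=1$) and $p(\gamma_i,\gamma_{i+1},c)$ is on the left of $c$ (no condition if $i=n$), and let $\mathfrak I'$ be defined in the same way with left and right exchanged. Then the projective cover and the injective envelope of $M(c)$ are $$P(M(c))\cong\bigoplus_{i\in\mathfrak I}M(c^{\gamma_i}_{\mathrm{proj}}),\qquad E(M(c))\cong\bigoplus_{i\in\mathfrak I'}M(c^{\gamma_i}_{\mathrm{inj}}).$$ (2) Let $c$ be a permissible closed curve and $\varphi$ an automorphism of a finite-dimensional $k$-space $V$. Let $\mathfrak I$ be the set of all $i$ modulo $n$ such that $p(\gamma_{i-1},\gamma_i,c)$ is on the right and $p(\gamma_i,\gamma_{i+1},c)$ is on the left of $c$, and let $\mathfrak I'$ be defined with left and right exchanged. Then $$P(M(c,\varphi))\cong\bigoplus_{i\in\mathfrak I}M(c^{\gamma_i}_{\mathrm{proj}})^{\oplus\dim_kV},\qquad E(M(c,\varphi))\cong\bigoplus_{i\in\mathfrak I'}M(c^{\gamma_i}_{\mathrm{inj}})^{\oplus\dim_kV}.$$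 -/

import Mathlib

/-! ### Projective covers and injective envelopes -/

/-- `P` is a projective cover of `M`: `P` is projective and there is an epimorphism `P → M`
with superfluous kernel. -/
def IsProjectiveCover (R P M : Type*) [Ring R] [AddCommGroup P] [Module R P]
    [AddCommGroup M] [Module R M] : Prop :=
  Module.Projective R P ∧ ∃ f : P →ₗ[R] M, Function.Surjective f ∧
    ∀ N : Submodule R P, N ⊔ LinearMap.ker f = ⊤ → N = ⊤

/-- `E` is an injective envelope of `M`: `E` is injective and there is a monomorphism `M → E`
with essential image. -/
def IsInjectiveEnvelope (R E M : Type*) [Ring R] [AddCommGroup E] [Module R E]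
    [AddCommGroup M] [Module R M] : Prop :=
  Module.Injective R E ∧ ∃ f : M →ₗ[R] E, Function.Injective f ∧
    ∀ N : Submodule R E, N ⊓ LinearMap.range f = ⊥ → N = ⊥

/-! ### Quivers with zero relations of length two, and their algebras -/

/-- A quiver with finitely many vertices, together with a set of pairs of arrows `(α, β)`:
the generators `αβ` of an ideal of the path algebra. -/
structure QuadraticQuiver where
  V : Type
  E : Type
  [fintypeV : Fintype V]
  src : E → V
  tgt : E → V
  rel : E → E → Prop

attribute [instance] QuadraticQuiver.fintypeV

namespace QuadraticQuiver

/-- The defining relations of `kQ/I` on the generators `e_v` (`v` a vertex) and the arrows. The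
product `αβ` of arrows is the path "first `α`, then `β`" if `tgt α = src β`, and `0` otherwise. -/
inductive AlgRel (Q : QuadraticQuiver) (k : Type*) [Field k] :
    FreeAlgebra k (Q.V ⊕ Q.E) → FreeAlgebra k (Q.V ⊕ Q.E) → Prop
  | idem (v : Q.V) : AlgRel Q k
      (FreeAlgebra.ι k (Sum.inl v) * FreeAlgebra.ι k (Sum.inl v)) (FreeAlgebra.ι k (Sum.inl v))
  | orth (v w : Q.V) : v ≠ w → AlgRel Q k
      (FreeAlgebra.ι k (Sum.inl v) * FreeAlgebra.ι k (Sum.inl w)) 0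
  | one : AlgRel Q k (∑ v : Q.V, FreeAlgebra.ι k (Sum.inl v)) 1
  | src (α : Q.E) : AlgRel Q k
      (FreeAlgebra.ι k (Sum.inl (Q.src α)) * FreeAlgebra.ι k (Sum.inr α))
      (FreeAlgebra.ι k (Sum.inr α))
  | tgt (α : Q.E) : AlgRel Q k
      (FreeAlgebra.ι k (Sum.inr α) * FreeAlgebra.ι k (Sum.inl (Q.tgt α)))
      (FreeAlgebra.ι k (Sum.inr α))
  | rel (α β : Q.E) : Q.rel α β → AlgRel Q k
      (FreeAlgebra.ι k (Sum.inr α) * FreeAlgebra.ι k (Sum.inr β)) 0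

/-- The algebra `kQ/I`. Right modules over it are modules over `(Q.Alg k)ᵐᵒᵖ`. -/
abbrev Alg (Q : QuadraticQuiver) (k : Type*) [Field k] : Type _ := RingQuot (Q.AlgRel k)

/-- A finite quiver (`X` the vertices, `Y` the arrows) with a map to `Q` under which no path of
length two becomes a relation: the common shape of a string and of a band. -/
structure Diagram (Q : QuadraticQuiver) where
  X : Type
  Y : Type
  [fintypeX : Fintype X]
  [fintypeY : Fintype Y]
  tail : Y → X
  head : Y → X
  vert : X → Q.V
  lab : Y → Q.E
  src_lab : ∀ y, Q.src (lab y) = vert (tail y)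
  tgt_lab : ∀ y, Q.tgt (lab y) = vert (head y)
  norel : ∀ y z, head y = tail z → ¬ Q.rel (lab y) (lab z)

attribute [instance] Diagram.fintypeX Diagram.fintypeY

namespace Diagram

variable {Q : QuadraticQuiver} (D : Q.Diagram) (k : Type*) [Field k]
  (U : Type*) [AddCommGroup U] [Module k U] (θ : D.Y → (U ≃ₗ[k] U))

open Classical in
/-- The vertex `v` of `Q` acts as the projection to the copies of `U` lying over `v`. -/
noncomputable def vertexAct (v : Q.V) : Module.End k (D.X → U) :=
  LinearMap.pi fun x => if D.vert x = v then LinearMap.proj x else 0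

open Classical in
/-- The arrow `α` of `Q` acts through the maps `θ y : U_(tail y) → U_(head y)`, where `y` runs
over the arrows of the diagram lying over `α`. -/
noncomputable def arrowAct (α : Q.E) : Module.End k (D.X → U) :=
  ∑ y : D.Y, if D.lab y = α then
    LinearMap.single k (fun _ => U) (D.head y) ∘ₗ (θ y).toLinearMap ∘ₗ LinearMap.proj (D.tail y)
  else 0

open Classical in
lemma vertexAct_apply (v : Q.V) (f : D.X → U) (x : D.X) :
    D.vertexAct k U v f x = if D.vert x = v then f x else 0 := by
  simp only [vertexAct, LinearMap.pi_apply]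
  split_ifs <;> simp

open Classical in
lemma arrowAct_apply (α : Q.E) (f : D.X → U) :
    D.arrowAct k U θ α f =
      ∑ y : D.Y, if D.lab y = α then Pi.single (D.head y) (θ y (f (D.tail y))) else 0 := by
  simp only [arrowAct, LinearMap.sum_apply]
  refine Finset.sum_congr rfl fun y _ => ?_
  split_ifs <;> simp

/-- The action on generators, as a homomorphism to the opposite of the endomorphism ring (right
modules: `m · (ab) = (m · a) · b`). -/
noncomputable def freeLift :
    FreeAlgebra k (Q.V ⊕ Q.E) →ₐ[k] (Module.End k (D.X → U))ᵐᵒᵖ :=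
  FreeAlgebra.lift k fun g => MulOpposite.op
    (Sum.elim (D.vertexAct k U) (D.arrowAct k U θ) g)

lemma freeLift_rel ⦃a b : FreeAlgebra k (Q.V ⊕ Q.E)⦄ (h : Q.AlgRel k a b) :
    D.freeLift k U θ a = D.freeLift k U θ b := by
  classical
  apply MulOpposite.unop_injective
  ext1 i
  ext u x
  cases h with
  | idem v =>
    simp only [freeLift, map_mul, FreeAlgebra.lift_ι_apply, Sum.elim_inl, MulOpposite.unop_mul,
      MulOpposite.unop_op, LinearMap.comp_apply, Module.End.mul_apply, vertexAct_apply]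
    split_ifs <;> rfl
  | orth v w hvw =>
    simp only [freeLift, map_mul, FreeAlgebra.lift_ι_apply, Sum.elim_inl, MulOpposite.unop_mul,
      MulOpposite.unop_op, map_zero, MulOpposite.unop_zero, LinearMap.comp_apply,
      Module.End.mul_apply, vertexAct_apply, LinearMap.zero_apply, Pi.zero_apply]
    split_ifs with h1 h2
    · exact absurd (h2.symm.trans h1) hvw
    · rfl
    · rfl
  | one =>
    simp [freeLift, vertexAct_apply, Finset.sum_apply]
  | src α =>
    simp only [freeLift, map_mul, FreeAlgebra.lift_ι_apply, Sum.elim_inl, Sum.elim_inr,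
      MulOpposite.unop_mul, MulOpposite.unop_op, LinearMap.comp_apply, Module.End.mul_apply,
      arrowAct_apply, vertexAct_apply]
    refine congrFun (Finset.sum_congr rfl fun y _ => ?_) x
    split_ifs with h1 h2
    · rfl
    · exact absurd (by rw [← h1, D.src_lab]) h2
    · rfl
  | tgt α =>
    simp only [freeLift, map_mul, FreeAlgebra.lift_ι_apply, Sum.elim_inl, Sum.elim_inr,
      MulOpposite.unop_mul, MulOpposite.unop_op, LinearMap.comp_apply, Module.End.mul_apply,
      arrowAct_apply, vertexAct_apply, Finset.sum_apply]
    split_ifs with h0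
    · rfl
    · refine (Finset.sum_eq_zero fun y _ => ?_).symm
      split_ifs with h1
      · refine Pi.single_eq_of_ne ?_ _
        rintro rfl
        exact h0 (by rw [← h1, D.tgt_lab])
      · rfl
  | rel α β hr =>
    simp only [freeLift, map_mul, FreeAlgebra.lift_ι_apply, Sum.elim_inr,
      MulOpposite.unop_mul, MulOpposite.unop_op, LinearMap.comp_apply, Module.End.mul_apply,
      arrowAct_apply, map_zero, MulOpposite.unop_zero, LinearMap.zero_apply]
    refine congrFun (Finset.sum_eq_zero fun z _ => ?_) x
    split_ifs with h1
    · rw [Finset.sum_apply, Finset.sum_eq_zero fun y _ => ?_]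
      · simp
      · split_ifs with h2
        · refine Pi.single_eq_of_ne ?_ _
          intro h3
          exact D.norel y z h3.symm (by rw [h1, h2]; exact hr)
        · rfl
    · rfl

/-- The right action of `kQ/I` on the direct sum of copies of `U` indexed by the vertices of the
diagram. -/
noncomputable def toEnd : (Q.Alg k)ᵐᵒᵖ →ₐ[k] Module.End k (D.X → U) :=
  AlgHom.opComm (RingQuot.liftAlgHom k ⟨D.freeLift k U θ, D.freeLift_rel k U θ⟩)

/-- The right `kQ/I`-module of the diagram: a copy of `U` at each vertex, and the maps `θ y`
along the arrows. -/
def Mod {Q : QuadraticQuiver} (D : Q.Diagram) (k : Type*) [Field k] (U : Type*) [AddCommGroup U]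
    [Module k U] (_θ : D.Y → (U ≃ₗ[k] U)) : Type _ := D.X → U

instance : AddCommGroup (D.Mod k U θ) := inferInstanceAs (AddCommGroup (D.X → U))

instance : Module k (D.Mod k U θ) := inferInstanceAs (Module k (D.X → U))

noncomputable instance : Module (Q.Alg k)ᵐᵒᵖ (D.Mod k U θ) :=
  Module.compHom (D.X → U) (D.toEnd k U θ).toRingHom

end Diagram

/-! ### Strings, bands, and their modules -/

/-- A string `a_0 ⋯ a_(n-1)` through the vertices `vert 0, …, vert n`: the letter `a_i` is the
arrow `arrow i` if `direct i`, and its formal inverse otherwise; it joins `vert i` to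
`vert (i + 1)`. The walk is reduced and contains no relation and no inverse of a relation. -/
structure Str (Q : QuadraticQuiver) where
  n : ℕ
  vert : Fin (n + 1) → Q.V
  arrow : Fin n → Q.E
  direct : Fin n → Prop
  direct_src : ∀ i, direct i → Q.src (arrow i) = vert i.castSucc
  direct_tgt : ∀ i, direct i → Q.tgt (arrow i) = vert i.succ
  inverse_src : ∀ i, ¬ direct i → Q.src (arrow i) = vert i.succ
  inverse_tgt : ∀ i, ¬ direct i → Q.tgt (arrow i) = vert i.castSucc
  reduced : ∀ i j : Fin n, i.val + 1 = j.val → arrow i = arrow j → (direct i ↔ direct j)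
  direct_norel : ∀ i j : Fin n, i.val + 1 = j.val → direct i → direct j →
    ¬ Q.rel (arrow i) (arrow j)
  inverse_norel : ∀ i j : Fin n, i.val + 1 = j.val → ¬ direct i → ¬ direct j →
    ¬ Q.rel (arrow j) (arrow i)

open Classical in
/-- The underlying diagram `A_(n+1)` of a string. -/
noncomputable def Str.diagram {Q : QuadraticQuiver} (s : Q.Str) : Q.Diagram where
  X := Fin (s.n + 1)
  Y := Fin s.n
  tail i := if s.direct i then i.castSucc else i.succ
  head i := if s.direct i then i.succ else i.castSucc
  vert := s.vert
  lab := s.arrow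
  src_lab i := by
    split_ifs with h
    · exact s.direct_src i h
    · exact s.inverse_src i h
  tgt_lab i := by
    split_ifs with h
    · exact s.direct_tgt i h
    · exact s.inverse_tgt i h
  norel i j := by
    split_ifs with h1 h2 h2 <;> intro h
    · refine s.direct_norel i j ?_ h1 h2
      simpa [Fin.ext_iff] using h
    · exact absurd (Fin.succ_injective _ h ▸ h1) h2
    · exact absurd (Fin.castSucc_injective _ h ▸ h2) h1
    · refine s.inverse_norel j i ?_ h2 h1
      simpa [Fin.ext_iff, eq_comm] using h

/-- The string module `M(s)`. -/
abbrev Str.Mod {Q : QuadraticQuiver} (s : Q.Str) (k : Type*) [Field k] : Type _ :=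
  s.diagram.Mod k k fun _ => LinearEquiv.refl k k

/-- A cyclic string `a_0 ⋯ a_(n-1)` with `n ≥ 1`, all of whose powers are strings (a power of a
band): indices are taken modulo `n`, and the letter `a_i` joins `vert i` to `vert (i + 1)`. -/
structure CyclicStr (Q : QuadraticQuiver) where
  n : ℕ
  [neZero : NeZero n]
  vert : ZMod n → Q.V
  arrow : ZMod n → Q.E
  direct : ZMod n → Prop
  direct_src : ∀ i, direct i → Q.src (arrow i) = vert i
  direct_tgt : ∀ i, direct i → Q.tgt (arrow i) = vert (i + 1)
  inverse_src : ∀ i, ¬ direct i → Q.src (arrow i) = vert (i + 1)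
  inverse_tgt : ∀ i, ¬ direct i → Q.tgt (arrow i) = vert i
  reduced : ∀ i, arrow i = arrow (i + 1) → (direct i ↔ direct (i + 1))
  direct_norel : ∀ i, direct i → direct (i + 1) → ¬ Q.rel (arrow i) (arrow (i + 1))
  inverse_norel : ∀ i, ¬ direct i → ¬ direct (i + 1) → ¬ Q.rel (arrow (i + 1)) (arrow i)

attribute [instance] CyclicStr.neZero

open Classical in
/-- The underlying cyclic diagram of a cyclic string. -/
noncomputable def CyclicStr.diagram {Q : QuadraticQuiver} (b : Q.CyclicStr) : Q.Diagram where
  X := ZMod b.n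
  Y := ZMod b.n
  fintypeX := ZMod.fintype b.n
  fintypeY := ZMod.fintype b.n
  tail i := if b.direct i then i else i + 1
  head i := if b.direct i then i + 1 else i
  vert := b.vert
  lab := b.arrow
  src_lab i := by
    split_ifs with h
    · exact b.direct_src i h
    · exact b.inverse_src i h
  tgt_lab i := by
    split_ifs with h
    · exact b.direct_tgt i h
    · exact b.inverse_tgt i h
  norel i j := by
    split_ifs with h1 h2 h2 <;> intro h
    · subst h
      exact b.direct_norel i h1 h2
    · exact absurd (add_right_cancel h ▸ h1) h2
    · exact absurd (h ▸ h2) h1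
    · subst h
      exact b.inverse_norel j h2 h1

/-- The maps along the letters `a_0, …, a_(n-1)`: all the identity, except for `φ` along
`a_(n-1)`. -/
noncomputable def CyclicStr.twist {Q : QuadraticQuiver} (b : Q.CyclicStr) {k : Type*} [Field k]
    {U : Type*} [AddCommGroup U] [Module k U] (φ : U ≃ₗ[k] U) (i : b.diagram.Y) : U ≃ₗ[k] U :=
  open Classical in if (i : ZMod b.n) = (-1 : ZMod b.n) then φ else LinearEquiv.refl k U

/-- The module `M(b, φ)`: a copy of `U` at each vertex of `b`, the identity along
`a_0, …, a_(n-2)`, and `φ` along `a_(n-1)`. -/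
abbrev CyclicStr.Mod {Q : QuadraticQuiver} (b : Q.CyclicStr) (k : Type*) [Field k] (U : Type*)
    [AddCommGroup U] [Module k U] (φ : U ≃ₗ[k] U) : Type _ :=
  b.diagram.Mod k U (b.twist φ)

end QuadraticQuiver

/-! ### Marked ribbon surfaces -/

/-- The combinatorial data of an oriented surface cut by a system `Arc` of arcs into elementary
polygons. The polygon `j` has `size j ≥ 1` sides that are arcs and exactly one further side: a
segment of the boundary of the surface, or (if `unmarked j`) a whole boundary component without
marked points, around which the polygon is then wrapped.

The arc sides of `j` are indexed by `ZMod (size j)` so that `i + 1` follows `i` counterclockwise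
*about their common endpoint* (equivalently, the interior of `j` is on the right when `i, i + 1, …`
are traversed in this direction). If `j` is not `unmarked`, its boundary segment lies between
the side `-1` and the side `0`.

Each arc is a side exactly twice, once in each direction: `glue (j, i) = (a, true)` or `(a, false)`
says that the side `i` of `j`, traversed towards `i + 1`, is the arc `a` or its inverse. -/
structure PolygonGluing where
  Arc : Type
  Polygon : Type
  [fintypeArc : Fintype Arc]
  [fintypePolygon : Fintype Polygon]
  size : Polygon → ℕ
  [neZero : ∀ j, NeZero (size j)]
  unmarked : Polygon → Prop
  glue : (Σ j, ZMod (size j)) ≃ Arc × Bool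

attribute [instance] PolygonGluing.fintypeArc PolygonGluing.fintypePolygon PolygonGluing.neZero

namespace PolygonGluing

variable (S : PolygonGluing)

/-- The sides of the polygons that are arcs. -/
abbrev Side : Type := Σ j, ZMod (S.size j)

variable {S}

/-- The arc along which a side lies. -/
def arcOf (h : S.Side) : S.Arc := (S.glue h).1

/-- The other side of the same arc. -/
def flip (h : S.Side) : S.Side := S.glue.symm ((S.glue h).1, !(S.glue h).2)

/-- The following side of the same polygon (of interest only if `HasNext h`). -/
def next (h : S.Side) : S.Side := ⟨h.1, h.2 + 1⟩

/-- The side `h` is followed by another arc side of its polygon, not by the boundary segment. -/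
def HasNext (h : S.Side) : Prop := S.unmarked h.1 ∨ h.2 ≠ -1

/-- The side `h` is preceded by another arc side of its polygon, not by the boundary segment. -/
def HasPrev (h : S.Side) : Prop := S.unmarked h.1 ∨ h.2 ≠ 0

lemma arcOf_flip (h : S.Side) : arcOf (flip h) = arcOf h := by
  simp [arcOf, flip]

lemma flip_ne (h : S.Side) : flip h ≠ h := by
  intro e
  have := congrArg (fun x => (S.glue x).2) e
  simp [flip] at this

end PolygonGluing

/-- A marked ribbon surface, presented by its dissection into elementary polygons: it is
non-empty and connected, and all the marked points are on the boundary, i.e. on turning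
counterclockwise about an endpoint of an arc, from arc to arc, one ends at a boundary segment. -/
structure MarkedRibbonSurface extends PolygonGluing where
  nonempty : Nonempty Polygon
  connected : ∀ j j' : Polygon, Relation.ReflTransGen
    (fun j₁ j₂ => ∃ h : toPolygonGluing.Side, h.1 = j₁ ∧ (PolygonGluing.flip h).1 = j₂) j j'
  marked_boundary : ∀ h : toPolygonGluing.Side, ∃ n : ℕ,
    ¬ PolygonGluing.HasNext ((fun x => PolygonGluing.flip (PolygonGluing.next x))^[n] h)

namespace MarkedRibbonSurface

open PolygonGluing Set

variable (S : MarkedRibbonSurface)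

/-! #### The quiver with relations of a marked ribbon surface -/

/-- The quiver with relations of `S`: the vertices are the arcs of `S`, and there is an arrow
`u → v` for each pair of sides `u, v` of an elementary polygon such that `v` follows `u`
counterclockwise about their common endpoint; the products of two successive arrows that come from
three successive sides of the same polygon are relations. -/
def quiver : QuadraticQuiver where
  V := S.Arc
  E := {h : S.Side // HasNext h}
  src α := arcOf α.1
  tgt α := arcOf (next α.1)
  rel α β := β.1 = next α.1

/-- The algebra `A_S = kQ_S/I_S`. -/
abbrev Alg (k : Type*) [Field k] : Type _ := S.quiver.Alg k

/-! #### The surface as a topological space -/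

/-- The model of the polygon `j` is the rectangle `[0, size j] × [0, 1]`, or, if `j` is unmarked,
the strip `ℝ × [0, 1]` covering the annulus. The side `i` is `[i, i + 1] × {1}`; the remaining
three edges of the rectangle form the boundary segment, and the line `ℝ × {0}` covers the unmarked
boundary component. -/
def cell (j : S.Polygon) : Set (ℝ × ℝ) :=
  {p | 0 ≤ p.2 ∧ p.2 ≤ 1 ∧ (S.unmarked j ∨ (0 ≤ p.1 ∧ p.1 ≤ S.size j))}

/-- The interior of the polygon. -/
def openCell (j : S.Polygon) : Set (ℝ × ℝ) :=
  {p | 0 < p.2 ∧ p.2 < 1 ∧ (S.unmarked j ∨ (0 < p.1 ∧ p.1 < S.size j))}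

/-- The identifications: unmarked polygons are wrapped up to annuli, and the two sides along the
same arc are glued, reversing the direction. -/
inductive Glued : (Σ j, S.cell j) → (Σ j, S.cell j) → Prop
  | wrap (j : S.Polygon) (p q : S.cell j) : S.unmarked j →
      q.1 = (p.1.1 + S.size j, p.1.2) → Glued ⟨j, p⟩ ⟨j, q⟩
  | side (h : S.Side) (x : ℝ) (p : S.cell h.1) (q : S.cell (flip h).1) : x ∈ Icc (0 : ℝ) 1 →
      p.1 = (h.2.val + x, 1) → q.1 = ((flip h).2.val + (1 - x), 1) →
      Glued ⟨h.1, p⟩ ⟨(flip h).1, q⟩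

/-- The surface, with the quotient topology. -/
abbrev Surface : Type := Quot S.Glued

/-- `s` is the point of the surface with coordinates `p` in the polygon `j`. -/
def IsPoint (j : S.Polygon) (p : ℝ × ℝ) (s : S.Surface) : Prop :=
  ∃ h : p ∈ S.cell j, s = Quot.mk _ ⟨j, p, h⟩

variable {S}

/-- The side of the polygon `j` over which `[l, l + 1] × {1}` lies (for `0 ≤ l < size j` if `j` is
not unmarked). -/
def sideAt (j : S.Polygon) (l : ℤ) : S.Side := ⟨j, (l : ZMod (S.size j))⟩

/-- `p` is in the interior of the side `[l, l + 1] × {1}`. -/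
def OnSide (l : ℤ) (p : ℝ × ℝ) : Prop := p.2 = 1 ∧ (l : ℝ) < p.1 ∧ p.1 < l + 1

lemma hasNext_of_onSide {j : S.Polygon} {l : ℤ} {p q : ℝ × ℝ} (hp : p ∈ S.cell j)
    (hq : q ∈ S.cell j) (h1 : OnSide l p) (h2 : OnSide (l + 1) q) : HasNext (sideAt j l) := by
  by_cases hu : S.unmarked j
  · exact Or.inl hu
  · refine Or.inr ?_
    have hp' := (hp.2.2.resolve_left hu).1
    have hq' := (hq.2.2.resolve_left hu).2
    obtain ⟨-, -, h1⟩ := h1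
    obtain ⟨-, h2, -⟩ := h2
    have a : (0 : ℝ) < ((l + 1 : ℤ) : ℝ) := by push_cast; linarith
    have b : ((l + 1 : ℤ) : ℝ) < ((S.size j : ℤ) : ℝ) := by push_cast at h2 ⊢; linarith
    have a' : 0 < l + 1 := by exact_mod_cast a
    have b' : l + 1 < S.size j := by exact_mod_cast b
    intro e
    have e' : ((l + 1 : ℤ) : ZMod (S.size j)) = 0 := by
      have : (l : ZMod (S.size j)) = -1 := e
      push_cast
      rw [this]
      ring
    rw [ZMod.intCast_zmod_eq_zero_iff_dvd] at e'
    exact absurd (Int.le_of_dvd a' e') (not_le.mpr b')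

lemma sideAt_add_one (j : S.Polygon) (l : ℤ) : sideAt j (l + 1) = next (sideAt j l) := by
  simp only [sideAt, next, Int.cast_add, Int.cast_one]
  rfl

/-! #### Permissible curves -/

/-- The restriction of the curve `c` to `[a, b]` runs in the polygon `j`, inside the open polygon
except for its ends; `ℓ` gives its coordinates there. -/
structure IsSegment (c : ℝ → S.Surface) (a b : ℝ) (j : S.Polygon) (ℓ : ℝ → ℝ × ℝ) : Prop where
  continuousOn : ContinuousOn ℓ (Icc a b)
  isPoint : ∀ t ∈ Icc a b, S.IsPoint j (ℓ t) (c t)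
  interior : ∀ t ∈ Ioo a b, ℓ t ∈ S.openCell j

/-- `p` is an admissible endpoint for an end segment in `j` crossing the side `l`. Either `p` is a
marked point (a corner of `j`) which is not an endpoint of that side, so that the crossing cannot
be removed by a homotopy, and the winding number of the segment about an unmarked boundary
component is `0` or `1`; or `p` is the extra point of the polygon `j` with one side in the arc
system and one boundary segment. -/
def IsEndpoint (j : S.Polygon) (l : ℤ) (p : ℝ × ℝ) : Prop :=
  (∃ q : ℤ, p = ((q : ℝ), 1) ∧ q ≠ l ∧ q ≠ l + 1 ∧
      l - 2 * S.size j < q ∧ q < l + 1 + 2 * S.size j) ∨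
    (¬ S.unmarked j ∧ S.size j = 1 ∧ p = (1 / 2, 0))

variable (S) in
/-- A non-trivial permissible curve: a continuous curve `c : [0, 1] → S` consecutively crossing
arcs `γ_0, …, γ_n` at the times `time 1 < ⋯ < time (n + 1)`; the segments `0` and `n + 1` are its
end segments. For `i ≤ n`, the segment `i` leaves its polygon through the side `exit i`, and the
segment `i + 1` enters its polygon through the side `entry (i + 1)`, the other side of the same
arc `γ_i`. Each middle segment cuts off a triangle: the sides `entry i` and `exit i` are
neighbouring, with common endpoint `p(γ_(i-1), γ_i, c)`. (Values at indices outside these ranges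
are of no significance.) -/
structure PermissibleCurve where
  toFun : ℝ → S.Surface
  continuousOn : ContinuousOn toFun (Icc 0 1)
  n : ℕ
  time : ℕ → ℝ
  time_zero : time 0 = 0
  time_last : time (n + 2) = 1
  time_lt : ∀ i ≤ n + 1, time i < time (i + 1)
  poly : ℕ → S.Polygon
  coord : ℕ → ℝ → ℝ × ℝ
  entry : ℕ → ℤ
  exit : ℕ → ℤ
  segment : ∀ i ≤ n + 1, IsSegment toFun (time i) (time (i + 1)) (poly i) (coord i)
  exit_mem : ∀ i ≤ n, OnSide (exit i) (coord i (time (i + 1)))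
  entry_mem : ∀ i ≤ n, OnSide (entry (i + 1)) (coord (i + 1) (time (i + 1)))
  cross : ∀ i ≤ n, sideAt (poly (i + 1)) (entry (i + 1)) = flip (sideAt (poly i) (exit i))
  triangle : ∀ i, 1 ≤ i → i ≤ n → exit i = entry i + 1 ∨ exit i = entry i - 1
  start : IsEndpoint (poly 0) (exit 0) (coord 0 0)
  finish : IsEndpoint (poly (n + 1)) (entry (n + 1)) (coord (n + 1) 1)

namespace PermissibleCurve

variable (c : S.PermissibleCurve)

/-- The arc `γ_i` crossed by `c`, for `i ≤ n`. -/
def arc (i : ℕ) : S.Arc := arcOf (sideAt (c.poly i) (c.exit i))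

/-- The vertex `p(γ_(i-1), γ_i, c)` of the triangle cut off by the middle segment `i`
(`1 ≤ i ≤ n`) is on the left of `c`. (Below the edge `ℝ × {1}`, a path from `[l, l + 1] × {1}` to
`[l + 1, l + 2] × {1}` has the point `(l + 1, 1)` on its left.) -/
def IsLeft (i : ℕ) : Prop := c.exit i = c.entry i + 1

/-- The vertex `p(γ_(i-1), γ_i, c)` of the triangle cut off by the middle segment `i`
(`1 ≤ i ≤ n`) is on the right of `c`. -/
def IsRight (i : ℕ) : Prop := c.exit i = c.entry i - 1

/-- `m` is the marked point `p(γ_(i-1), γ_i, c)`, for `1 ≤ i ≤ n`. -/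
def IsPivot (i : ℕ) (m : S.Surface) : Prop :=
  S.IsPoint (c.poly i) (((max (c.entry i) (c.exit i) : ℤ) : ℝ), 1) m

lemma isRight_of_not {i : ℕ} (h1 : 1 ≤ i) (h2 : i ≤ c.n) (h : ¬ c.IsLeft i) : c.IsRight i :=
  (c.triangle i h1 h2).resolve_left h

lemma entry_cell (i : ℕ) (h : i ≤ c.n) :
    c.coord (i + 1) (c.time (i + 1)) ∈ S.cell (c.poly (i + 1)) :=
  ((c.segment (i + 1) (by omega)).isPoint _
    (left_mem_Icc.2 (c.time_lt (i + 1) (by omega)).le)).1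

lemma exit_cell (i : ℕ) (h : i ≤ c.n) :
    c.coord i (c.time (i + 1)) ∈ S.cell (c.poly i) :=
  ((c.segment i (by omega)).isPoint _
    (right_mem_Icc.2 (c.time_lt i (by omega)).le)).1

lemma hasNext_left {i : ℕ} (hi : i + 1 ≤ c.n) (h : c.IsLeft (i + 1)) :
    HasNext (sideAt (c.poly (i + 1)) (c.entry (i + 1))) := by
  have e := c.exit_mem (i + 1) hi
  rw [h] at e
  exact hasNext_of_onSide (c.entry_cell i (by omega)) (c.exit_cell (i + 1) hi)
    (c.entry_mem i (by omega)) e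

lemma entry_eq {i : ℕ} (h : c.IsRight i) : c.entry i = c.exit i + 1 := by
  unfold IsRight at h
  omega

lemma hasNext_right {i : ℕ} (hi : i + 1 ≤ c.n) (h : c.IsRight (i + 1)) :
    HasNext (sideAt (c.poly (i + 1)) (c.exit (i + 1))) := by
  have e := c.entry_mem i (by omega)
  rw [c.entry_eq h] at e
  exact hasNext_of_onSide (c.exit_cell (i + 1) hi) (c.entry_cell i (by omega))
    (c.exit_mem (i + 1) hi) e

open Classical in
/-- The arrow of the quiver given by the triangle cut off by the middle segment `i + 1`
(`i < n`): it is `γ_i → γ_(i+1)` if the vertex of the triangle is on the left, i.e. `c` crosses the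
two arcs counterclockwise about it, and `γ_(i+1) → γ_i` otherwise. -/
noncomputable def arrow (i : ℕ) (hi : i + 1 ≤ c.n) : S.quiver.E :=
  if h : c.IsLeft (i + 1) then
    ⟨sideAt (c.poly (i + 1)) (c.entry (i + 1)), c.hasNext_left hi h⟩
  else ⟨sideAt (c.poly (i + 1)) (c.exit (i + 1)),
    c.hasNext_right hi (c.isRight_of_not (by omega) hi h)⟩

lemma arrow_left {i : ℕ} (hi : i + 1 ≤ c.n) (h : c.IsLeft (i + 1)) :
    (c.arrow i hi).1 = sideAt (c.poly (i + 1)) (c.entry (i + 1)) := by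
  simp [arrow, h]

lemma next_arrow_left {i : ℕ} (hi : i + 1 ≤ c.n) (h : c.IsLeft (i + 1)) :
    next (c.arrow i hi).1 = sideAt (c.poly (i + 1)) (c.exit (i + 1)) := by
  rw [c.arrow_left hi h, ← sideAt_add_one, h]

lemma arrow_right {i : ℕ} (hi : i + 1 ≤ c.n) (h : ¬ c.IsLeft (i + 1)) :
    (c.arrow i hi).1 = sideAt (c.poly (i + 1)) (c.exit (i + 1)) := by
  simp [arrow, h]

lemma next_arrow_right {i : ℕ} (hi : i + 1 ≤ c.n) (h : ¬ c.IsLeft (i + 1)) :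
    next (c.arrow i hi).1 = sideAt (c.poly (i + 1)) (c.entry (i + 1)) := by
  rw [c.arrow_right hi h, ← sideAt_add_one,
    ← c.entry_eq (c.isRight_of_not (by omega) hi h)]

lemma arcOf_entry {i : ℕ} (hi : i ≤ c.n) :
    arcOf (sideAt (c.poly (i + 1)) (c.entry (i + 1))) = c.arc i := by
  rw [c.cross i hi, arcOf_flip, arc]

/-- The string of a permissible curve. -/
noncomputable def str : S.quiver.Str where
  n := c.n
  vert i := c.arc i
  arrow i := c.arrow i i.2
  direct i := c.IsLeft (i.val + 1)
  direct_src i h := by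
    change arcOf (c.arrow i i.2).1 = _
    rw [c.arrow_left i.2 h]
    exact c.arcOf_entry i.2.le
  direct_tgt i h := by
    change arcOf (next (c.arrow i i.2).1) = _
    rw [c.next_arrow_left i.2 h]
    rfl
  inverse_src i h := by
    change arcOf (c.arrow i i.2).1 = _
    rw [c.arrow_right i.2 h]
    rfl
  inverse_tgt i h := by
    change arcOf (next (c.arrow i i.2).1) = _
    rw [c.next_arrow_right i.2 h]
    exact c.arcOf_entry i.2.le
  reduced i j hij e := by
    obtain ⟨i, hi⟩ := i
    obtain ⟨j, hj⟩ := j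
    obtain rfl : i + 1 = j := hij
    have e1 := congrArg Subtype.val e
    have e2 := congrArg next e1
    have cr := c.cross (i + 1) hi
    by_cases h1 : c.IsLeft (i + 1) <;> by_cases h2 : c.IsLeft (i + 1 + 1)
    · exact iff_of_true h1 h2
    · rw [c.next_arrow_left hi h1, c.next_arrow_right hj h2, cr] at e2
      exact absurd e2.symm (flip_ne _)
    · rw [c.arrow_right hi h1, c.arrow_left hj h2, cr] at e1
      exact absurd e1.symm (flip_ne _)
    · exact iff_of_false h1 h2
  direct_norel i j hij h1 h2 e := by
    obtain ⟨i, hi⟩ := i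
    obtain ⟨j, hj⟩ := j
    obtain rfl : i + 1 = j := hij
    change (c.arrow (i + 1) hj).1 = next (c.arrow i hi).1 at e
    rw [c.next_arrow_left hi h1, c.arrow_left hj h2, c.cross (i + 1) hi] at e
    exact flip_ne _ e
  inverse_norel i j hij h1 h2 e := by
    obtain ⟨i, hi⟩ := i
    obtain ⟨j, hj⟩ := j
    obtain rfl : i + 1 = j := hij
    change (c.arrow i hi).1 = next (c.arrow (i + 1) hj).1 at e
    rw [c.next_arrow_right hj h2, c.arrow_right hi h1, c.cross (i + 1) hi] at e
    exact flip_ne _ e.symm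

/-- The string module `M(c)`. -/
abbrev Mod (k : Type*) [Field k] : Type _ := c.str.Mod k

/-- The indices `i` such that `p(γ_(i-1), γ_i, c)` is on the right and `p(γ_i, γ_(i+1), c)` is on
the left of `c`, where a condition on a point is void if that point does not exist
(`i = 0` or `i = n`). -/
def TopIndex : Type :=
  {i : Fin (c.n + 1) // (1 ≤ i.val → c.IsRight i.val) ∧ (i.val + 1 ≤ c.n → c.IsLeft (i.val + 1))}

/-- The indices `i` such that `p(γ_(i-1), γ_i, c)` is on the left and `p(γ_i, γ_(i+1), c)` is on
the right of `c`, where a condition on a point is void if that point does not exist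
(`i = 0` or `i = n`). -/
def SocIndex : Type :=
  {i : Fin (c.n + 1) // (1 ≤ i.val → c.IsLeft i.val) ∧ (i.val + 1 ≤ c.n → c.IsRight (i.val + 1))}

/-- `c` is a projective permissible curve of the arc `γ`: for some `i` with `γ_i = γ`, the points
`p(γ_0, γ_1, c) = ⋯ = p(γ_(i-1), γ_i, c)` agree and are on the right of `c`, the points
`p(γ_i, γ_(i+1), c) = ⋯ = p(γ_(n-1), γ_n, c)` agree and are on the left of `c`, and `c` is maximal:
there is no arc which precedes `γ_0` clockwise about its endpoint on the right of `c`, and none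
which follows `γ_n` counterclockwise about its endpoint on the left of `c`. -/
def IsProjective (γ : S.Arc) : Prop :=
  ∃ i ≤ c.n, c.arc i = γ ∧
    (∃ m, ∀ a, 1 ≤ a → a ≤ i → c.IsRight a ∧ c.IsPivot a m) ∧
    (∃ m, ∀ a, i + 1 ≤ a → a ≤ c.n → c.IsLeft a ∧ c.IsPivot a m) ∧
    ¬ HasNext (sideAt (c.poly 0) (c.exit 0)) ∧
    ¬ HasNext (sideAt (c.poly (c.n + 1)) (c.entry (c.n + 1)))

/-- `c` is an injective permissible curve of the arc `γ`: the same with left and right, and with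
clockwise and counterclockwise, interchanged. -/
def IsInjective (γ : S.Arc) : Prop :=
  ∃ i ≤ c.n, c.arc i = γ ∧
    (∃ m, ∀ a, 1 ≤ a → a ≤ i → c.IsLeft a ∧ c.IsPivot a m) ∧
    (∃ m, ∀ a, i + 1 ≤ a → a ≤ c.n → c.IsRight a ∧ c.IsPivot a m) ∧
    ¬ HasPrev (sideAt (c.poly 0) (c.exit 0)) ∧
    ¬ HasPrev (sideAt (c.poly (c.n + 1)) (c.entry (c.n + 1)))

end PermissibleCurve

/-! #### Permissible closed curves -/

variable (S) in
/-- A permissible closed curve: a continuous `1`-periodic `c : ℝ → S` consecutively crossing arcs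
`γ_i` at the times `time i`, with `n ≥ 1` crossings in a period. The segment `i` lies between the
crossings `i` and `i + 1`, enters its polygon through the side `entry i`, leaves it through
`exit i`, and cuts off a triangle with vertex `p(γ_i, γ_(i+1), c)`. -/
structure PermissibleClosedCurve where
  toFun : ℝ → S.Surface
  continuous : Continuous toFun
  periodic : Function.Periodic toFun 1
  n : ℕ
  [neZero : NeZero n]
  time : ℤ → ℝ
  time_lt : ∀ i, time i < time (i + 1)
  time_period : ∀ i, time (i + n) = time i + 1
  poly : ZMod n → S.Polygon
  coord : ℤ → ℝ → ℝ × ℝ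
  entry : ZMod n → ℤ
  exit : ZMod n → ℤ
  segment : ∀ i : ℤ, IsSegment toFun (time i) (time (i + 1)) (poly i) (coord i)
  entry_mem : ∀ i : ℤ, OnSide (entry i) (coord i (time i))
  exit_mem : ∀ i : ℤ, OnSide (exit i) (coord i (time (i + 1)))
  cross : ∀ i, sideAt (poly (i + 1)) (entry (i + 1)) = flip (sideAt (poly i) (exit i))
  triangle : ∀ i, exit i = entry i + 1 ∨ exit i = entry i - 1

attribute [instance] PermissibleClosedCurve.neZero

namespace PermissibleClosedCurve

variable (c : S.PermissibleClosedCurve)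

/-- The arc `γ_i` crossed by `c`. -/
def arc (i : ZMod c.n) : S.Arc := arcOf (sideAt (c.poly i) (c.entry i))

/-- The point `p(γ_i, γ_(i+1), c)` is on the left of `c`. -/
def IsLeft (i : ZMod c.n) : Prop := c.exit i = c.entry i + 1

/-- The point `p(γ_i, γ_(i+1), c)` is on the right of `c`. -/
def IsRight (i : ZMod c.n) : Prop := c.exit i = c.entry i - 1

lemma entry_eq {i : ZMod c.n} (h : ¬ c.IsLeft i) : c.entry i = c.exit i + 1 := by
  have := (c.triangle i).resolve_left h
  omega

lemma exists_mem (i : ZMod c.n) : ∃ p ∈ S.cell (c.poly i), ∃ q ∈ S.cell (c.poly i),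
    OnSide (c.entry i) p ∧ OnSide (c.exit i) q := by
  obtain ⟨l, rfl⟩ := ZMod.intCast_surjective i
  have hs := (c.segment l).isPoint
  exact ⟨_, (hs _ (left_mem_Icc.2 (c.time_lt l).le)).1, _,
    (hs _ (right_mem_Icc.2 (c.time_lt l).le)).1, c.entry_mem l, c.exit_mem l⟩

lemma hasNext_left {i : ZMod c.n} (h : c.IsLeft i) : HasNext (sideAt (c.poly i) (c.entry i)) := by
  obtain ⟨p, hp, q, hq, h1, h2⟩ := c.exists_mem i
  rw [h] at h2
  exact hasNext_of_onSide hp hq h1 h2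

lemma hasNext_right {i : ZMod c.n} (h : ¬ c.IsLeft i) :
    HasNext (sideAt (c.poly i) (c.exit i)) := by
  obtain ⟨p, hp, q, hq, h1, h2⟩ := c.exists_mem i
  rw [c.entry_eq h] at h1
  exact hasNext_of_onSide hq hp h2 h1

open Classical in
/-- The arrow given by the triangle cut off by the segment `i`: `γ_i → γ_(i+1)` if its vertex is
on the left, and `γ_(i+1) → γ_i` otherwise. -/
noncomputable def arrow (i : ZMod c.n) : S.quiver.E :=
  if h : c.IsLeft i then ⟨sideAt (c.poly i) (c.entry i), c.hasNext_left h⟩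
  else ⟨sideAt (c.poly i) (c.exit i), c.hasNext_right h⟩

lemma arrow_left {i : ZMod c.n} (h : c.IsLeft i) :
    (c.arrow i).1 = sideAt (c.poly i) (c.entry i) := by
  simp [arrow, h]

lemma next_arrow_left {i : ZMod c.n} (h : c.IsLeft i) :
    next (c.arrow i).1 = sideAt (c.poly i) (c.exit i) := by
  rw [c.arrow_left h, ← sideAt_add_one, h]

lemma arrow_right {i : ZMod c.n} (h : ¬ c.IsLeft i) :
    (c.arrow i).1 = sideAt (c.poly i) (c.exit i) := by
  simp [arrow, h]

lemma next_arrow_right {i : ZMod c.n} (h : ¬ c.IsLeft i) :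
    next (c.arrow i).1 = sideAt (c.poly i) (c.entry i) := by
  rw [c.arrow_right h, ← sideAt_add_one, ← c.entry_eq h]

lemma arcOf_exit (i : ZMod c.n) :
    arcOf (sideAt (c.poly i) (c.exit i)) = c.arc (i + 1) := by
  rw [arc, c.cross i, arcOf_flip]

/-- The cyclic string (a power of a band) of a permissible closed curve. -/
noncomputable def str : S.quiver.CyclicStr where
  n := c.n
  vert := c.arc
  arrow := c.arrow
  direct := c.IsLeft
  direct_src i h := by
    change arcOf (c.arrow i).1 = _
    rw [c.arrow_left h]
    rfl
  direct_tgt i h := by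
    change arcOf (next (c.arrow i).1) = _
    rw [c.next_arrow_left h]
    exact c.arcOf_exit i
  inverse_src i h := by
    change arcOf (c.arrow i).1 = _
    rw [c.arrow_right h]
    exact c.arcOf_exit i
  inverse_tgt i h := by
    change arcOf (next (c.arrow i).1) = _
    rw [c.next_arrow_right h]
    rfl
  reduced i e := by
    have e1 := congrArg Subtype.val e
    have e2 := congrArg next e1
    by_cases h1 : c.IsLeft i <;> by_cases h2 : c.IsLeft (i + 1)
    · exact iff_of_true h1 h2
    · rw [c.next_arrow_left h1, c.next_arrow_right h2, c.cross i] at e2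
      exact absurd e2.symm (flip_ne _)
    · rw [c.arrow_right h1, c.arrow_left h2, c.cross i] at e1
      exact absurd e1.symm (flip_ne _)
    · exact iff_of_false h1 h2
  direct_norel i h1 h2 e := by
    change (c.arrow (i + 1)).1 = next (c.arrow i).1 at e
    rw [c.next_arrow_left h1, c.arrow_left h2, c.cross i] at e
    exact flip_ne _ e
  inverse_norel i h1 h2 e := by
    change (c.arrow i).1 = next (c.arrow (i + 1)).1 at e
    rw [c.next_arrow_right h2, c.arrow_right h1, c.cross i] at e
    exact flip_ne _ e.symm

/-- The band module `M(c, φ)`. -/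
abbrev Mod (k : Type*) [Field k] (U : Type*) [AddCommGroup U] [Module k U] (φ : U ≃ₗ[k] U) :
    Type _ :=
  c.str.Mod k U φ

/-- The indices `i` modulo `n` such that `p(γ_(i-1), γ_i, c)` is on the right and
`p(γ_i, γ_(i+1), c)` is on the left of `c`. -/
def TopIndex : Type := {i : ZMod c.n // c.IsRight (i - 1) ∧ c.IsLeft i}

/-- The indices `i` modulo `n` such that `p(γ_(i-1), γ_i, c)` is on the left and
`p(γ_i, γ_(i+1), c)` is on the right of `c`. -/
def SocIndex : Type := {i : ZMod c.n // c.IsLeft (i - 1) ∧ c.IsRight i}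

end PermissibleClosedCurve

end MarkedRibbonSurface

/-! String and band modules are both diagram modules: a copy of a space `U` at each vertex of a
finite quiver over `Q`, and an isomorphism along each arrow. If every vertex is reached from
vertices at which no arrow ends, the copies of `U` at these tops generate the module; dually, the
vertices at which no arrow starts detect its nonzero elements. For a curve, these two sets of
vertices are the index sets of the statement.

The diagram of a projective permissible curve of `γ` is a tree with arrows pointing away from a root
over `γ`. It is maximal: an arrow of `Q` starting at one of its vertices either continues the tree
or forms a relation with the arrow entering that vertex. So a homomorphism out of the tree module
amounts to a free choice of its values on the root, within the part of the target over `γ`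
(`ProjForest.lift`, `ProjForest.hom_ext`), and projectivity follows from a `k`-linear section on the
roots. Sending roots to tops gives the cover: it is surjective, and elements of its kernel vanish at
the roots, which makes the kernel superfluous by a Nakayama argument on depth
(`ProjForest.isProjectiveCover`). Only invertibility of the maps along the arrows matters, so `φ`
enters the answer through `dim V` alone; `sigmaEquiv` turns a disjoint union of trees with
coefficients in `V` into `dim V` copies of each tree module.

The injective half is done directly on trees pointing towards the root: `InjForest.colift` coextends
linear maps to the roots, Baer's criterion follows from a `k`-linear retraction onto the ideal, and
essentiality from the fact that arrows lower the depth of the support.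

The geometry enters through `marked_boundary`. Two successive arrows that do not form a relation
turn about the same endpoint, so `rank` drops (`rank_lt_of_not_rel`). Hence no diagram contains an
endless oriented path, and in particular a closed curve has tops and socles (`induction_from_tops`,
`induction_from_socles`). The same finiteness gives existence of the projective and injective
curves: turn about both ends of the arc until the boundary is met, then realise the sequence of
sides by a continuous curve (`exists_permissibleCurve`). -/

/-! ### Generators of the opposite algebra -/

namespace QuadraticQuiver

section Generators

variable {Q : QuadraticQuiver} (k : Type*) [Field k]

/-- The idempotent of a vertex, acting on right modules. -/
noncomputable def idem (v : Q.V) : (Q.Alg k)ᵐᵒᵖ :=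
  MulOpposite.op (RingQuot.mkAlgHom k (Q.AlgRel k) (FreeAlgebra.ι k (Sum.inl v)))

/-- An arrow, acting on right modules. -/
noncomputable def arr (α : Q.E) : (Q.Alg k)ᵐᵒᵖ :=
  MulOpposite.op (RingQuot.mkAlgHom k (Q.AlgRel k) (FreeAlgebra.ι k (Sum.inr α)))

lemma idem_mul_self (v : Q.V) : idem k v * idem k v = idem k v := by
  simp only [idem, ← MulOpposite.op_mul, ← map_mul]
  rw [RingQuot.mkAlgHom_rel k (AlgRel.idem v)]

lemma idem_mul_of_ne {v w : Q.V} (h : v ≠ w) : idem k v * idem k w = 0 := by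
  simp only [idem, ← MulOpposite.op_mul, ← map_mul]
  rw [RingQuot.mkAlgHom_rel k (AlgRel.orth w v h.symm), map_zero, MulOpposite.op_zero]

/-- Products are reversed in the opposite algebra: a path acts with its first arrow rightmost, so
the source idempotent stands on the right and the target idempotent on the left. -/
lemma arr_mul_idem_src (α : Q.E) : arr k α * idem k (Q.src α) = arr k α := by
  simp only [idem, arr, ← MulOpposite.op_mul, ← map_mul]
  rw [RingQuot.mkAlgHom_rel k (AlgRel.src α)]

lemma idem_tgt_mul_arr (α : Q.E) : idem k (Q.tgt α) * arr k α = arr k α := by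
  simp only [idem, arr, ← MulOpposite.op_mul, ← map_mul]
  rw [RingQuot.mkAlgHom_rel k (AlgRel.tgt α)]

lemma arr_mul_arr_of_rel {α β : Q.E} (h : Q.rel α β) : arr k β * arr k α = 0 := by
  simp only [arr, ← MulOpposite.op_mul, ← map_mul]
  rw [RingQuot.mkAlgHom_rel k (AlgRel.rel α β h), map_zero, MulOpposite.op_zero]

variable {k}

/-- A `k`-linear map between right `kQ/I`-modules is `kQ/I`-linear if it commutes with the vertices
and the arrows. -/
lemma map_smul_of_generators {M N : Type*} [AddCommGroup M] [AddCommGroup N] [Module k M]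
    [Module k N] [Module (Q.Alg k)ᵐᵒᵖ M] [Module (Q.Alg k)ᵐᵒᵖ N]
    [IsScalarTower k (Q.Alg k)ᵐᵒᵖ M] [IsScalarTower k (Q.Alg k)ᵐᵒᵖ N] (f : M →ₗ[k] N)
    (hv : ∀ (v : Q.V) m, f (idem k v • m) = idem k v • f m)
    (ha : ∀ (α : Q.E) m, f (arr k α • m) = arr k α • f m) (r : (Q.Alg k)ᵐᵒᵖ) (m : M) :
    f (r • m) = r • f m := by
  obtain ⟨a, rfl⟩ := MulOpposite.op_surjective r
  obtain ⟨a, rfl⟩ := RingQuot.mkAlgHom_surjective k (Q.AlgRel k) a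
  induction a using FreeAlgebra.induction generalizing m with
  | grade0 c =>
    rw [AlgHom.commutes, ← MulOpposite.algebraMap_apply, algebraMap_smul, algebraMap_smul,
      map_smul]
  | grade1 x =>
    rcases x with v | α
    · exact hv v m
    · exact ha α m
  | mul a b iha ihb => rw [map_mul, MulOpposite.op_mul, mul_smul, mul_smul, ihb, iha]
  | add a b iha ihb => rw [map_add, MulOpposite.op_add, add_smul, add_smul, map_add, iha, ihb]

end Generators

/-! ### The action on the module of a diagram -/

namespace Diagram

section Action

variable {Q : QuadraticQuiver} (D : Q.Diagram) (k : Type*) [Field k]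
  (U : Type*) [AddCommGroup U] [Module k U] (θ : D.Y → (U ≃ₗ[k] U))

instance : IsScalarTower k (Q.Alg k)ᵐᵒᵖ (D.Mod k U θ) where
  smul_assoc c r m := by
    change D.toEnd k U θ (c • r) m = c • D.toEnd k U θ r m
    rw [map_smul]
    rfl

open Classical in
/-- The inclusion of the copy of `U` at the vertex `x`. -/
noncomputable def single (x : D.X) : U →ₗ[k] D.Mod k U θ :=
  LinearMap.single k (fun _ => U) x

variable {k U}

/-- Gives access to the action on representatives in the free algebra; the explicit formulas for
vertices and arrows below are read off from it. -/
lemma toEnd_op_mk (a : FreeAlgebra k (Q.V ⊕ Q.E)) :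
    D.toEnd k U θ (MulOpposite.op (RingQuot.mkAlgHom k (Q.AlgRel k) a)) =
      (D.freeLift k U θ a).unop := by
  rw [← RingQuot.liftAlgHom_mkAlgHom_apply k (D.freeLift k U θ) (D.freeLift_rel k U θ) a]
  rfl

open Classical in
lemma idem_smul_apply (v : Q.V) (f : D.Mod k U θ) (x : D.X) :
    (idem k v • f : D.Mod k U θ) x = if D.vert x = v then f x else 0 := by
  rw [← D.vertexAct_apply k U v f x]
  change D.toEnd k U θ (MulOpposite.op (RingQuot.mkAlgHom k _ _)) f x = _
  rw [toEnd_op_mk, freeLift, FreeAlgebra.lift_ι_apply]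
  rfl

open Classical in
lemma arr_smul (α : Q.E) (f : D.Mod k U θ) :
    arr k α • f = ∑ y : D.Y, if D.lab y = α then D.single k U θ (D.head y) (θ y (f (D.tail y)))
      else 0 := by
  refine Eq.trans ?_ (D.arrowAct_apply k U θ α f)
  change D.toEnd k U θ (MulOpposite.op (RingQuot.mkAlgHom k _ _)) f = _
  rw [toEnd_op_mk, freeLift, FreeAlgebra.lift_ι_apply]
  rfl

lemma single_same (x : D.X) (u : U) : D.single k U θ x u x = u := by
  classical
  exact Pi.single_eq_same (M := fun _ => U) x u

lemma single_of_ne {x z : D.X} (h : z ≠ x) (u : U) : D.single k U θ x u z = 0 := by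
  classical
  exact Pi.single_eq_of_ne (M := fun _ => U) h u

lemma sum_single (f : D.Mod k U θ) : ∑ x, D.single k U θ x (f x) = f := by
  classical
  exact Finset.univ_sum_single (M := fun _ => U) f

variable {θ} in
lemma sum_apply {ι : Type*} (s : Finset ι) (g : ι → D.Mod k U θ) (x : D.X) :
    (∑ i ∈ s, g i) x = ∑ i ∈ s, g i x := Finset.sum_apply (M := fun _ => U) x s g

variable {θ} in
lemma add_apply (f g : D.Mod k U θ) (x : D.X) : (f + g) x = f x + g x := rfl

/-- Different arrows with the same tail have different labels. -/
def OutInjective : Prop := ∀ y y', D.tail y = D.tail y' → D.lab y = D.lab y' → y = y'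

/-- Different arrows with the same head have different labels. -/
def InInjective : Prop := ∀ y y', D.head y = D.head y' → D.lab y = D.lab y' → y = y'

lemma idem_smul_single (x : D.X) (u : U) :
    idem k (D.vert x) • D.single k U θ x u = D.single k U θ x u := by
  funext z
  rw [idem_smul_apply]
  split_ifs with h
  · rfl
  · rw [single_of_ne]
    rintro rfl
    exact h rfl

variable {D} in
-- Among the arrows with label `D.lab y`, only `y` starts at `D.tail y`, so a single summand
-- survives.
lemma OutInjective.arr_smul_single (hD : D.OutInjective) (y : D.Y) (u : U) :
    arr k (D.lab y) • D.single k U θ (D.tail y) u = D.single k U θ (D.head y) (θ y u) := by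
  classical
  rw [arr_smul, Finset.sum_eq_single y]
  · rw [if_pos rfl, single_same]
  · intro z _ hz
    split_ifs with h
    · rw [single_of_ne, map_zero, map_zero]
      exact fun e => hz (hD _ _ e h)
    · rfl
  · simp

variable {D} in
lemma InInjective.arr_smul_apply (hD : D.InInjective) (y : D.Y) (f : D.Mod k U θ) :
    (arr k (D.lab y) • f : D.Mod k U θ) (D.head y) = θ y (f (D.tail y)) := by
  classical
  rw [arr_smul, sum_apply, Finset.sum_eq_single y]
  · rw [if_pos rfl, single_same]
  · intro z _ hz
    split_ifs with h
    · rw [single_of_ne]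
      exact fun e => hz (hD _ _ e.symm h)
    · rfl
  · simp

lemma arr_smul_apply_of_forall_ne (α : Q.E) (f : D.Mod k U θ) (x : D.X)
    (h : ∀ y, D.head y = x → D.lab y ≠ α) : (arr k α • f : D.Mod k U θ) x = 0 := by
  classical
  rw [arr_smul, sum_apply]
  refine Finset.sum_eq_zero fun y _ => ?_
  split_ifs with e
  · exact single_of_ne _ _ (fun e' => h y e'.symm e) _
  · rfl

lemma arr_smul_single_of_forall_ne (α : Q.E) (x : D.X) (u : U)
    (h : ∀ y, D.tail y = x → D.lab y ≠ α) : arr k α • D.single k U θ x u = 0 := by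
  classical
  rw [arr_smul]
  refine Finset.sum_eq_zero fun y _ => ?_
  split_ifs with e
  · rw [single_of_ne _ _ (fun e' => h y e' e), map_zero, map_zero]
  · rfl

end Action

end Diagram

end QuadraticQuiver

/-! ### Forests of projective type -/

namespace QuadraticQuiver

namespace Diagram

/-- The diagram module all of whose maps are identities. -/
abbrev Free {Q : QuadraticQuiver} (D : Q.Diagram) (k : Type*) [Field k] (U : Type*)
    [AddCommGroup U] [Module k U] : Type _ :=
  D.Mod k U fun _ => LinearEquiv.refl k U

/-- The components of the diagram are rooted trees, indexed by `T`, with arrows pointing away from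
the roots, which cannot be enlarged to trees with the same roots. -/
structure ProjForest {Q : QuadraticQuiver} (D : Q.Diagram) (T : Type) where
  root : T → D.X
  comp : D.X → T
  depth : D.X → ℕ
  comp_head : ∀ y, comp (D.head y) = comp (D.tail y)
  depth_head : ∀ y, depth (D.head y) = depth (D.tail y) + 1
  depth_root : ∀ t, depth (root t) = 0
  comp_root : ∀ t, comp (root t) = t
  root_comp : ∀ x, depth x = 0 → root (comp x) = x
  exists_parent : ∀ x, depth x ≠ 0 → ∃ y, D.head y = x
  head_injective : Function.Injective D.head
  outInjective : D.OutInjective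
  exists_child : ∀ x α, Q.src α = D.vert x →
    (∃ y, D.tail y = x ∧ D.lab y = α) ∨ ∃ y, D.head y = x ∧ Q.rel (D.lab y) α

namespace ProjForest

variable {Q : QuadraticQuiver} {D : Q.Diagram} {T : Type}

open Classical in
/-- The path from the root to the vertex `x`. -/
noncomputable def path (F : D.ProjForest T) (k : Type*) [Field k] (x : D.X) : (Q.Alg k)ᵐᵒᵖ :=
  if h : ∃ y, D.head y = x then arr k (D.lab h.choose) * path F k (D.tail h.choose)
  else idem k (D.vert x)
termination_by F.depth x
decreasing_by
  have h1 := h.choose_spec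
  have h2 := F.depth_head h.choose
  rw [h1] at h2
  omega

variable (F : D.ProjForest T) (k : Type*) [Field k]

/-- The arrow chosen in the definition of `path` must be `y`, because a vertex has at most one
incoming arrow. -/
lemma path_head (y : D.Y) :
    F.path k (D.head y) = arr k (D.lab y) * F.path k (D.tail y) := by
  have h : ∃ z, D.head z = D.head y := ⟨y, rfl⟩
  rw [path, dif_pos h, F.head_injective h.choose_spec]

lemma head_ne_root (y : D.Y) (t : T) : D.head y ≠ F.root t := by
  intro e
  have := F.depth_head y
  rw [e, F.depth_root] at this
  omega

lemma path_root (t : T) : F.path k (F.root t) = idem k (D.vert (F.root t)) := by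
  rw [path, dif_neg]
  rintro ⟨y, e⟩
  exact F.head_ne_root y t e

lemma eq_root_or_eq_head (x : D.X) : x = F.root (F.comp x) ∨ ∃ y, D.head y = x := by
  by_cases h : F.depth x = 0
  · exact Or.inl (F.root_comp x h).symm
  · exact Or.inr (F.exists_parent x h)

lemma idem_mul_path (x : D.X) : idem k (D.vert x) * F.path k x = F.path k x := by
  rcases F.eq_root_or_eq_head x with h | ⟨y, rfl⟩
  · rw [h, path_root, idem_mul_self]
  · rw [path_head, ← D.tgt_lab, ← mul_assoc, idem_tgt_mul_arr]

/-- This is where maximality of the tree is used. An arrow that does not continue the tree at `x`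
either starts at another vertex of `Q`, so that orthogonal idempotents meet, or forms a relation
with the last arrow of the path. It makes the extension from the roots compatible with arrows
leaving the tree. -/
lemma arr_mul_path_of_forall_ne (α : Q.E) (x : D.X) (h : ∀ y, D.tail y = x → D.lab y ≠ α) :
    arr k α * F.path k x = 0 := by
  by_cases hs : Q.src α = D.vert x
  · rcases F.exists_child x α hs with ⟨y, h1, h2⟩ | ⟨y, rfl, h2⟩
    · exact absurd h2 (h y h1)
    · rw [path_head, ← mul_assoc, arr_mul_arr_of_rel k h2, zero_mul]
  · rw [← F.idem_mul_path k x, ← arr_mul_idem_src, mul_assoc, ← mul_assoc (idem k (Q.src α)),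
      idem_mul_of_ne k hs, zero_mul, mul_zero]

variable {k} {U : Type*} [AddCommGroup U] [Module k U]

/-- A tree module is determined by its roots. -/
lemma hom_ext {N : Type*} [AddCommGroup N] [Module (Q.Alg k)ᵐᵒᵖ N]
    {f f' : D.Free k U →ₗ[(Q.Alg k)ᵐᵒᵖ] N}
    (h : ∀ t u, f (D.single k U _ (F.root t) u) = f' (D.single k U _ (F.root t) u)) :
    f = f' := by
  have key : ∀ d x, F.depth x = d → ∀ u, f (D.single k U _ x u) = f' (D.single k U _ x u) := by
    intro d
    induction d with
    | zero =>
      intro x hx u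
      rw [← F.root_comp x hx, h]
    | succ d ih =>
      intro x hx u
      obtain ⟨y, rfl⟩ := F.exists_parent x (by omega)
      have e := F.outInjective.arr_smul_single (k := k) (U := U)
        (fun _ => LinearEquiv.refl k U) y u
      rw [LinearEquiv.refl_apply] at e
      rw [← e, map_smul, map_smul, ih _ (by have := F.depth_head y; omega)]
  ext m
  rw [← D.sum_single _ m, map_sum, map_sum]
  exact Finset.sum_congr rfl fun x _ => key _ x rfl _

variable {N : Type*} [AddCommGroup N] [Module k N] [Module (Q.Alg k)ᵐᵒᵖ N]
  [IsScalarTower k (Q.Alg k)ᵐᵒᵖ N]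

/-- The extension of `k`-linear maps on the roots, as a `k`-linear map. -/
noncomputable def liftAux (g : T → U →ₗ[k] N) : D.Free k U →ₗ[k] N where
  toFun f := ∑ x, F.path k x • g (F.comp x) (f x)
  map_add' f f' := by
    rw [← Finset.sum_add_distrib]
    refine Finset.sum_congr rfl fun x _ => ?_
    rw [add_apply, map_add, smul_add]
  map_smul' c f := by
    rw [Finset.smul_sum]
    refine Finset.sum_congr rfl fun x _ => ?_
    change F.path k x • g (F.comp x) (c • f x) = c • (F.path k x • g (F.comp x) (f x))
    rw [map_smul, smul_algebra_smul_comm]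

lemma liftAux_single (g : T → U →ₗ[k] N) (x : D.X) (u : U) :
    F.liftAux g (D.single k U _ x u) = F.path k x • g (F.comp x) u := by
  change ∑ z, _ = _
  rw [Finset.sum_eq_single x]
  · rw [single_same]
  · intro z _ h
    rw [single_of_ne _ _ h, map_zero, smul_zero]
  · simp

/-- The extension of `k`-linear maps on the roots. -/
noncomputable def lift (g : T → U →ₗ[k] N) : D.Free k U →ₗ[(Q.Alg k)ᵐᵒᵖ] N :=
  { F.liftAux g with
    map_smul' := by
      refine map_smul_of_generators (F.liftAux g) ?_ ?_
      · intro v f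
        rw [← D.sum_single _ f, Finset.smul_sum, map_sum, map_sum, Finset.smul_sum]
        refine Finset.sum_congr rfl fun x _ => ?_
        by_cases h : v = D.vert x
        · subst h
          rw [idem_smul_single, liftAux_single, smul_smul, idem_mul_path]
        · rw [liftAux_single, smul_smul, ← idem_mul_path, ← mul_assoc, idem_mul_of_ne k h,
            zero_mul, zero_smul, ← idem_smul_single, smul_smul, idem_mul_of_ne k h, zero_smul,
            map_zero]
      · intro α f
        rw [← D.sum_single _ f, Finset.smul_sum, map_sum, map_sum, Finset.smul_sum]
        refine Finset.sum_congr rfl fun x _ => ?_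
        by_cases h : ∃ y, D.tail y = x ∧ D.lab y = α
        · obtain ⟨y, rfl, rfl⟩ := h
          rw [F.outInjective.arr_smul_single, liftAux_single, liftAux_single, path_head,
            mul_smul, F.comp_head]
          rfl
        · have h' : ∀ y, D.tail y = x → D.lab y ≠ α := fun y h1 h2 => h ⟨y, h1, h2⟩
          rw [arr_smul_single_of_forall_ne _ _ _ _ _ h', liftAux_single, smul_smul,
            arr_mul_path_of_forall_ne _ _ _ _ h', zero_smul, map_zero] }

lemma lift_single (g : T → U →ₗ[k] N) (x : D.X) (u : U) :
    F.lift g (D.single k U _ x u) = F.path k x • g (F.comp x) u :=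
  F.liftAux_single g x u

/-- A forest of projective type gives a projective module. -/
lemma projective (F : D.ProjForest T) : Module.Projective (Q.Alg k)ᵐᵒᵖ (D.Free k U) := by
  refine Module.Projective.of_lifting_property'' fun f hf => ?_
  -- A section that is merely `k`-linear suffices: restrict it to the roots and extend by `lift`.
  -- The composite with `f` fixes the roots, hence is the identity.
  obtain ⟨s, hs⟩ := LinearMap.exists_rightInverse_of_surjective (f.restrictScalars k)
    (LinearMap.range_eq_top.2 hf)
  refine ⟨F.lift (N := D.Free k U →₀ (Q.Alg k)ᵐᵒᵖ) fun t => s ∘ₗ D.single k U _ (F.root t),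
    F.hom_ext fun t u => ?_⟩
  have hs' : ∀ m, f (s m) = m := fun m => LinearMap.congr_fun hs m
  rw [LinearMap.comp_apply, lift_single, F.path_root, F.comp_root, map_smul, LinearMap.comp_apply,
    hs', idem_smul_single]
  rfl

/-- The submodule argument behind Nakayama's lemma: the span of the non-roots is superfluous. -/
lemma eq_top_of_sup_ker_eq_top {N : Type*} [AddCommGroup N] [Module (Q.Alg k)ᵐᵒᵖ N]
    (f : D.Free k U →ₗ[(Q.Alg k)ᵐᵒᵖ] N) (hf : ∀ m, f m = 0 → ∀ t, m (F.root t) = 0)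
    (W : Submodule (Q.Alg k)ᵐᵒᵖ (D.Free k U)) (hW : W ⊔ LinearMap.ker f = ⊤) : W = ⊤ := by
  -- Every element is approximated by elements of `W` up to any given depth; beyond the maximal
  -- depth the approximation is exact.
  have key : ∀ d m, ∃ w ∈ W, ∀ x, F.depth x < d → (m - w : D.Free k U) x = 0 := by
    intro d
    induction d with
    | zero => exact fun m => ⟨0, W.zero_mem, fun x hx => absurd hx (by omega)⟩
    | succ d ih =>
      intro m
      obtain ⟨w, hw, q, hq, rfl⟩ := Submodule.mem_sup.1 (hW ▸ Submodule.mem_top : m ∈ _)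
      have hq' := hf q hq
      -- The kernel part `q` has no root component, so each of its components is an arrow applied to
      -- a component one level higher. Approximating the latter to depth `d` and applying the arrow
      -- gives depth `d + 1`.
      have step : ∀ x, ∃ w ∈ W, ∀ z, F.depth z < d + 1 →
          (D.single k U (fun _ => LinearEquiv.refl k U) x (q x) - w : D.Free k U) z = 0 := by
        intro x
        rcases F.eq_root_or_eq_head x with h | ⟨y, rfl⟩
        · refine ⟨0, W.zero_mem, fun z _ => ?_⟩
          rw [h, hq', map_zero, sub_zero]
          rfl
        · have e := F.outInjective.arr_smul_single (k := k) (U := U)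
            (fun _ => LinearEquiv.refl k U) y (q (D.head y))
          rw [LinearEquiv.refl_apply] at e
          obtain ⟨w, hw, h⟩ := ih (D.single k U _ (D.tail y) (q (D.head y)))
          refine ⟨arr k (D.lab y) • w, W.smul_mem _ hw, fun z hz => ?_⟩
          rw [← e, ← smul_sub]
          by_cases hz' : ∃ y', D.head y' = z ∧ D.lab y' = D.lab y
          · obtain ⟨y', rfl, hl⟩ := hz'
            have hI : D.InInjective := fun a b hab _ => F.head_injective hab
            rw [← hl, hI.arr_smul_apply, LinearEquiv.refl_apply]
            exact h _ (by have := F.depth_head y'; omega)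
          · exact arr_smul_apply_of_forall_ne _ _ _ _ _ fun y' h1 h2 => hz' ⟨y', h1, h2⟩
      choose w' hw' h' using step
      refine ⟨w + ∑ x, w' x, W.add_mem hw (W.sum_mem fun x _ => hw' x), fun z hz => ?_⟩
      have e : w + q - (w + ∑ x, w' x) =
          ∑ x, (D.single k U (fun _ => LinearEquiv.refl k U) x (q x) - w' x) := by
        rw [Finset.sum_sub_distrib, D.sum_single]
        abel
      rw [e, sum_apply]
      exact Finset.sum_eq_zero fun x _ => h' x z hz
  refine eq_top_iff.2 fun m _ => ?_
  obtain ⟨w, hw, h⟩ := key (Finset.univ.sup F.depth + 1) m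
  have : m = w := by
    rw [← sub_eq_zero]
    funext x
    exact h x (Nat.lt_succ_of_le (Finset.le_sup (Finset.mem_univ x)))
  rwa [this]

/-- A forest of projective type whose roots match the vertices of a diagram at which no arrow ends
gives a projective cover. -/
theorem isProjectiveCover {D' : Q.Diagram} (θ : D'.Y → (U ≃ₗ[k] U)) (top : T → D'.X)
    (hinj : Function.Injective top) (hvert : ∀ t, D.vert (F.root t) = D'.vert (top t))
    (htop : ∀ t y, D'.head y ≠ top t) (hout : D'.OutInjective)
    (hreach : ∀ p : D'.X → Prop, (∀ t, p (top t)) → (∀ y, p (D'.tail y) → p (D'.head y)) →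
      ∀ x, p x) :
    IsProjectiveCover (Q.Alg k)ᵐᵒᵖ (D.Free k U) (D'.Mod k U θ) := by
  let f : D.Free k U →ₗ[(Q.Alg k)ᵐᵒᵖ] D'.Mod k U θ := F.lift fun t => D'.single k U θ (top t)
  have froot : ∀ t u, f (D.single k U _ (F.root t) u) = D'.single k U θ (top t) u := by
    intro t u
    rw [lift_single, F.path_root, F.comp_root, hvert, idem_smul_single]
  refine ⟨F.projective, f, ?_, F.eq_top_of_sup_ker_eq_top f ?_⟩
  · rw [← LinearMap.range_eq_top, eq_top_iff]
    intro m _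
    rw [← D'.sum_single _ m]
    refine Submodule.sum_mem _ fun x _ => ?_
    refine hreach (fun x => ∀ u, D'.single k U θ x u ∈ LinearMap.range f) (fun t u => ?_)
      (fun y h u => ?_) x _
    · exact ⟨_, froot t u⟩
    · rw [← (θ y).apply_symm_apply u, ← hout.arr_smul_single]
      exact Submodule.smul_mem _ _ (h _)
  · intro m hm t
    -- Non-root components lie in images of arrows, which vanish at `top t` since no arrow of `D'`
    -- ends there.
    have e : f m (top t) = m (F.root t) := by
      rw [← D.sum_single _ m, map_sum, sum_apply, sum_apply]
      refine Finset.sum_congr rfl fun x _ => ?_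
      rcases F.eq_root_or_eq_head x with h | ⟨y, rfl⟩
      · rw [h, froot]
        by_cases ht : t = F.comp x
        · rw [ht, single_same, single_same]
        · rw [single_of_ne _ _ (fun e => ht (hinj e)), single_of_ne]
          intro e
          apply ht
          rw [← F.comp_root t, e, F.comp_root]
      · have e := F.outInjective.arr_smul_single (k := k) (U := U)
          (fun _ => LinearEquiv.refl k U) y (m (D.head y))
        rw [LinearEquiv.refl_apply] at e
        rw [single_of_ne _ _ (F.head_ne_root y t).symm, ← e, map_smul]
        exact arr_smul_apply_of_forall_ne _ _ _ _ _ fun z hz => absurd hz (htop t z)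
    rw [← e, hm]
    rfl

end ProjForest

end Diagram

end QuadraticQuiver

/-! ### Forests of injective type -/

namespace QuadraticQuiver

namespace Diagram

/-- The components of the diagram are rooted trees, indexed by `T`, with arrows pointing towards
the roots, which cannot be enlarged to trees with the same roots. -/
structure InjForest {Q : QuadraticQuiver} (D : Q.Diagram) (T : Type) where
  root : T → D.X
  comp : D.X → T
  depth : D.X → ℕ
  comp_tail : ∀ y, comp (D.tail y) = comp (D.head y)
  depth_tail : ∀ y, depth (D.tail y) = depth (D.head y) + 1
  depth_root : ∀ t, depth (root t) = 0
  comp_root : ∀ t, comp (root t) = t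
  root_comp : ∀ x, depth x = 0 → root (comp x) = x
  exists_parent : ∀ x, depth x ≠ 0 → ∃ y, D.tail y = x
  tail_injective : Function.Injective D.tail
  inInjective : D.InInjective
  exists_child : ∀ x α, Q.tgt α = D.vert x →
    (∃ y, D.head y = x ∧ D.lab y = α) ∨ ∃ y, D.tail y = x ∧ Q.rel α (D.lab y)

/-- The value at the vertex `x`. -/
def coord {Q : QuadraticQuiver} (D : Q.Diagram) (k : Type*) [Field k] (U : Type*)
    [AddCommGroup U] [Module k U] (θ : D.Y → (U ≃ₗ[k] U)) (x : D.X) : D.Mod k U θ →ₗ[k] U :=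
  LinearMap.proj (φ := fun _ => U) x

namespace InjForest

variable {Q : QuadraticQuiver} {D : Q.Diagram} {T : Type}

open Classical in
/-- The path from the vertex `x` to the root. -/
noncomputable def path (F : D.InjForest T) (k : Type*) [Field k] (x : D.X) : (Q.Alg k)ᵐᵒᵖ :=
  if h : ∃ y, D.tail y = x then path F k (D.head h.choose) * arr k (D.lab h.choose)
  else idem k (D.vert x)
termination_by F.depth x
decreasing_by
  have h1 := h.choose_spec
  have h2 := F.depth_tail h.choose
  rw [h1] at h2
  omega

variable (F : D.InjForest T) (k : Type*) [Field k]

lemma path_tail (y : D.Y) :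
    F.path k (D.tail y) = F.path k (D.head y) * arr k (D.lab y) := by
  have h : ∃ z, D.tail z = D.tail y := ⟨y, rfl⟩
  rw [path, dif_pos h, F.tail_injective h.choose_spec]

lemma tail_ne_root (y : D.Y) (t : T) : D.tail y ≠ F.root t := by
  intro e
  have := F.depth_tail y
  rw [e, F.depth_root] at this
  omega

lemma path_root (t : T) : F.path k (F.root t) = idem k (D.vert (F.root t)) := by
  rw [path, dif_neg]
  rintro ⟨y, e⟩
  exact F.tail_ne_root y t e

lemma eq_root_or_eq_tail (x : D.X) : x = F.root (F.comp x) ∨ ∃ y, D.tail y = x := by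
  by_cases h : F.depth x = 0
  · exact Or.inl (F.root_comp x h).symm
  · exact Or.inr (F.exists_parent x h)

lemma path_mul_idem (x : D.X) : F.path k x * idem k (D.vert x) = F.path k x := by
  rcases F.eq_root_or_eq_tail x with h | ⟨y, rfl⟩
  · rw [h, path_root, idem_mul_self]
  · rw [path_tail, ← D.src_lab, mul_assoc, arr_mul_idem_src]

/-- Maximality in the dual form: an arrow ending over `x` but not in the tree is killed by the path
from `x` to the root, through a relation or through orthogonal idempotents. -/
lemma path_mul_arr_of_forall_ne (α : Q.E) (x : D.X) (h : ∀ y, D.head y = x → D.lab y ≠ α) :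
    F.path k x * arr k α = 0 := by
  by_cases hs : Q.tgt α = D.vert x
  · rcases F.exists_child x α hs with ⟨y, h1, h2⟩ | ⟨y, rfl, h2⟩
    · exact absurd h2 (h y h1)
    · rw [path_tail, mul_assoc, arr_mul_arr_of_rel k h2, mul_zero]
  · rw [← F.path_mul_idem k x, ← idem_tgt_mul_arr, mul_assoc, ← mul_assoc (idem k (D.vert x)),
      idem_mul_of_ne k (Ne.symm hs), zero_mul, mul_zero]

variable {k} {U : Type*} [AddCommGroup U] [Module k U]

/-- The path from `x` transports the value at `x` unchanged to the root, so an element is determined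
by the root values of its multiples. This is the reason for the formula defining `coliftAux`. -/
lemma path_smul_apply (m : D.Free k U) (x : D.X) :
    (F.path k x • m : D.Free k U) (F.root (F.comp x)) = m x := by
  classical
  have key : ∀ d x, F.depth x = d → ∀ m : D.Free k U,
      (F.path k x • m : D.Free k U) (F.root (F.comp x)) = m x := by
    intro d
    induction d with
    | zero =>
      intro x hx m
      rw [← F.root_comp x hx, F.path_root, F.comp_root, idem_smul_apply, if_pos rfl]
    | succ d ih =>
      intro x hx m
      obtain ⟨y, rfl⟩ := F.exists_parent x (by omega)
      rw [path_tail, mul_smul, F.comp_tail, ih _ (by have := F.depth_tail y; omega),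
        F.inInjective.arr_smul_apply]
      rfl
  exact key _ x rfl m

variable {N : Type*} [AddCommGroup N] [Module k N] [Module (Q.Alg k)ᵐᵒᵖ N]
  [IsScalarTower k (Q.Alg k)ᵐᵒᵖ N]

/-- The coextension of `k`-linear maps to the roots, as a `k`-linear map. -/
noncomputable def coliftAux (g : T → N →ₗ[k] U) : N →ₗ[k] D.Free k U where
  toFun n x := g (F.comp x) (F.path k x • n)
  map_add' n n' := by
    funext x
    change _ = g (F.comp x) (F.path k x • n) + g (F.comp x) (F.path k x • n')
    rw [smul_add, map_add]
  map_smul' c n := by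
    funext x
    change _ = c • g (F.comp x) (F.path k x • n)
    rw [smul_algebra_smul_comm, map_smul]

/-- The coextension of `k`-linear maps to the roots. -/
noncomputable def colift (g : T → N →ₗ[k] U) : N →ₗ[(Q.Alg k)ᵐᵒᵖ] D.Free k U :=
  { F.coliftAux g with
    map_smul' := by
      classical
      refine map_smul_of_generators (F.coliftAux g) ?_ ?_
      · intro v n
        funext x
        rw [idem_smul_apply]
        change g _ (F.path k x • idem k v • n) = if _ then g _ (F.path k x • n) else _
        split_ifs with h
        · rw [smul_smul, ← h, path_mul_idem]
        · rw [smul_smul, ← path_mul_idem, mul_assoc, idem_mul_of_ne k h, mul_zero, zero_smul,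
            map_zero]
      · intro α n
        funext x
        change g _ (F.path k x • arr k α • n) = _
        by_cases h : ∃ y, D.head y = x ∧ D.lab y = α
        · obtain ⟨y, rfl, rfl⟩ := h
          rw [F.inInjective.arr_smul_apply, smul_smul, ← path_tail, ← F.comp_tail]
          rfl
        · have h' : ∀ y, D.head y = x → D.lab y ≠ α := fun y h1 h2 => h ⟨y, h1, h2⟩
          rw [arr_smul_apply_of_forall_ne _ _ _ _ _ h', smul_smul,
            path_mul_arr_of_forall_ne _ _ _ _ h', zero_smul, map_zero] }

lemma colift_apply (g : T → N →ₗ[k] U) (n : N) (x : D.X) :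
    F.colift g n x = g (F.comp x) (F.path k x • n) := rfl

/-- A forest of injective type gives an injective module. -/
lemma baer (F : D.InjForest T) : Module.Baer (Q.Alg k)ᵐᵒᵖ (D.Free k U) := by
  intro I φ
  -- `s` is a `k`-linear retraction of the algebra onto the ideal. Composing it with `φ` and the
  -- root coordinates gives the linear maps to be coextended.
  obtain ⟨s, hs⟩ := LinearMap.exists_leftInverse_of_injective (I.subtype.restrictScalars k)
    (LinearMap.ker_eq_bot.2 I.subtype_injective)
  have hs' : ∀ a : I, s a = a := fun a => LinearMap.congr_fun hs a
  refine ⟨F.colift fun t => D.coord k U _ (F.root t) ∘ₗ φ.restrictScalars k ∘ₗ s, fun a ha => ?_⟩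
  funext x
  -- For `a` in the ideal, all multiples by paths stay in the ideal, where `s` is the identity; the
  -- coextension therefore agrees with `φ` there.
  have e : (F.path k x • a : (Q.Alg k)ᵐᵒᵖ) = ((F.path k x • (⟨a, ha⟩ : I) : I) : (Q.Alg k)ᵐᵒᵖ) :=
    rfl
  rw [colift_apply, LinearMap.comp_apply, LinearMap.comp_apply, e, hs',
    LinearMap.restrictScalars_apply, map_smul]
  exact F.path_smul_apply _ x

/-- The span of the roots is essential. -/
lemma eq_bot_of_inf_range_eq_bot (F : D.InjForest T) {M : Type*} [AddCommGroup M] [Module (Q.Alg k)ᵐᵒᵖ M]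
    (f : M →ₗ[(Q.Alg k)ᵐᵒᵖ] D.Free k U)
    (hf : ∀ n : D.Free k U, (∀ y, n (D.tail y) = 0) → n ∈ LinearMap.range f)
    (W : Submodule (Q.Alg k)ᵐᵒᵖ (D.Free k U)) (hW : W ⊓ LinearMap.range f = ⊥) : W = ⊥ := by
  -- Induction on the depth of the support. An arrow moves the support one level towards the root,
  -- so by induction all arrows kill `n`; then `n` is supported on the roots and lies in the range
  -- of `f`.
  have key : ∀ d, ∀ n ∈ W, (∀ x, d ≤ F.depth x → n x = 0) → n = 0 := by
    intro d
    induction d with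
    | zero =>
      intro n _ h
      funext x
      exact h x (Nat.zero_le _)
    | succ d ih =>
      intro n hn h
      have h0 : ∀ α : Q.E, arr k α • n = 0 := by
        intro α
        refine ih _ (W.smul_mem _ hn) fun x hx => ?_
        by_cases hy : ∃ y, D.head y = x ∧ D.lab y = α
        · obtain ⟨y, rfl, rfl⟩ := hy
          rw [F.inInjective.arr_smul_apply, h _ (by have := F.depth_tail y; omega), map_zero]
        · exact arr_smul_apply_of_forall_ne _ _ _ _ _ fun y h1 h2 => hy ⟨y, h1, h2⟩
      have h1 : n ∈ W ⊓ LinearMap.range f := by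
        refine ⟨hn, hf n fun y => ?_⟩
        have e := F.inInjective.arr_smul_apply (fun _ => LinearEquiv.refl k U) y n
        rw [h0, LinearEquiv.refl_apply] at e
        exact e.symm
      rw [hW] at h1
      exact h1
  refine eq_bot_iff.2 fun n hn => ?_
  refine key (Finset.univ.sup F.depth + 1) n hn fun x hx => ?_
  have := Finset.le_sup (f := F.depth) (Finset.mem_univ x)
  omega

/-- A forest of injective type whose roots match the vertices of a diagram at which no arrow starts
gives an essential extension. -/
theorem exists_essential {D' : Q.Diagram} (θ : D'.Y → (U ≃ₗ[k] U)) (soc : T → D'.X)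
    (hinj : Function.Injective soc) (hvert : ∀ t, D.vert (F.root t) = D'.vert (soc t))
    (hsoc : ∀ t y, D'.tail y ≠ soc t) (hin : D'.InInjective)
    (hreach : ∀ p : D'.X → Prop, (∀ t, p (soc t)) → (∀ y, p (D'.head y) → p (D'.tail y)) →
      ∀ x, p x) :
    ∃ f : D'.Mod k U θ →ₗ[(Q.Alg k)ᵐᵒᵖ] D.Free k U, Function.Injective f ∧
      ∀ W : Submodule (Q.Alg k)ᵐᵒᵖ (D.Free k U), W ⊓ LinearMap.range f = ⊥ → W = ⊥ := by
  classical
  let f : D'.Mod k U θ →ₗ[(Q.Alg k)ᵐᵒᵖ] D.Free k U := F.colift fun t => D'.coord k U θ (soc t)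
  have froot : ∀ m t, f m (F.root t) = m (soc t) := by
    intro m t
    rw [colift_apply, F.comp_root, F.path_root, hvert]
    change (idem k (D'.vert (soc t)) • m : D'.Mod k U θ) (soc t) = _
    rw [idem_smul_apply, if_pos rfl]
  refine ⟨f, ?_, F.eq_bot_of_inf_range_eq_bot f ?_⟩
  · rw [injective_iff_map_eq_zero]
    intro m hm
    funext x
    -- The property quantifies over the whole kernel because the induction step replaces `m` by a
    -- multiple by an arrow.
    refine hreach (fun x => ∀ m, f m = 0 → m x = 0) (fun t m hm => ?_) (fun y h m hm => ?_) x m hm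
    · exact (froot m t).symm.trans (congrFun hm _)
    · have e := h (arr k (D'.lab y) • m) (by rw [map_smul, hm, smul_zero])
      rw [hin.arr_smul_apply] at e
      exact (θ y).map_eq_zero_iff.1 e
  · intro n hn
    -- The preimage of an element `n` supported on the roots: its root values are placed at the
    -- matching socle vertices. No arrow starts there, so all arrows kill `m`, and `f m` vanishes
    -- off the roots.
    let m : D'.Mod k U θ := fun z => if h : ∃ t, soc t = z then n (F.root h.choose) else 0
    have hm : ∀ t, m (soc t) = n (F.root t) := by
      intro t
      have h : ∃ t', soc t' = soc t := ⟨t, rfl⟩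
      change (if h : ∃ t', soc t' = soc t then n (F.root h.choose) else 0) = _
      rw [dif_pos h, hinj h.choose_spec]
    have hm' : ∀ y, m (D'.tail y) = 0 := by
      intro y
      exact dif_neg fun ⟨t, e⟩ => hsoc t y e.symm
    have harr : ∀ α : Q.E, arr k α • m = 0 := by
      intro α
      rw [arr_smul]
      refine Finset.sum_eq_zero fun y _ => ?_
      rw [hm', map_zero, map_zero, ite_self]
    refine ⟨m, ?_⟩
    funext x
    rcases F.eq_root_or_eq_tail x with h | ⟨y, rfl⟩
    · rw [h, froot, hm]
    · rw [hn, colift_apply, path_tail, mul_smul, harr, smul_zero, map_zero]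

end InjForest

end Diagram

end QuadraticQuiver

/-! ### Transport along isomorphisms -/

/-- Superfluity of the kernel is tested on the image of the submodule under `e`. This passes from
the disjoint-union module to the direct sum in the statement. -/
lemma IsProjectiveCover.of_equiv {R P P' M : Type*} [Ring R] [AddCommGroup P] [Module R P]
    [AddCommGroup P'] [Module R P'] [AddCommGroup M] [Module R M] (h : IsProjectiveCover R P M)
    (e : P' ≃ₗ[R] P) : IsProjectiveCover R P' M := by
  obtain ⟨hP, f, hf, hs⟩ := h
  refine ⟨Module.Projective.of_equiv e.symm, f ∘ₗ e.toLinearMap, hf.comp e.surjective,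
    fun N hN => ?_⟩
  have h1 : N.map e.toLinearMap = ⊤ := by
    refine hs _ (eq_top_iff.2 fun p _ => ?_)
    obtain ⟨n, hn, q, hq, hnq⟩ := Submodule.mem_sup.1 (hN ▸ Submodule.mem_top : e.symm p ∈ _)
    refine Submodule.mem_sup.2 ⟨e n, Submodule.mem_map_of_mem hn, e q, hq, ?_⟩
    rw [← map_add, hnq, e.apply_symm_apply]
  refine eq_top_iff.2 fun p _ => ?_
  obtain ⟨n, hn, e'⟩ := (h1 ▸ Submodule.mem_top : e p ∈ N.map e.toLinearMap)
  rwa [← e.injective e']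

/-- Injectivity enters as Baer's criterion, which tests only ideals and so passes between modules in
different universes, whereas `Module.Injective` tests modules in the universe of the module itself.
-/
lemma IsInjectiveEnvelope.of_equiv {R E E' M : Type*} [Ring R] [AddCommGroup E] [Module R E]
    [AddCommGroup E'] [Module R E'] [AddCommGroup M] [Module R M] (hE : Module.Baer R E)
    (h : ∃ f : M →ₗ[R] E, Function.Injective f ∧
      ∀ N : Submodule R E, N ⊓ LinearMap.range f = ⊥ → N = ⊥)
    (e : E' ≃ₗ[R] E) : IsInjectiveEnvelope R E' M := by
  obtain ⟨f, hf, hs⟩ := h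
  refine ⟨(hE.of_equiv e.symm).injective, e.symm.toLinearMap ∘ₗ f, e.symm.injective.comp hf,
    fun N hN => ?_⟩
  have h1 : N.map e.toLinearMap = ⊥ := by
    refine hs _ (eq_bot_iff.2 ?_)
    rintro _ ⟨⟨n, hn, rfl⟩, m, hm⟩
    have h2 : n ∈ N ⊓ LinearMap.range (e.symm.toLinearMap ∘ₗ f) :=
      ⟨hn, m, by rw [LinearMap.comp_apply, hm]; exact e.symm_apply_apply n⟩
    rw [hN] at h2
    rw [show n = 0 from h2, map_zero]
    exact Submodule.zero_mem _
  refine eq_bot_iff.2 fun n hn => ?_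
  have h2 : e n ∈ N.map e.toLinearMap := Submodule.mem_map_of_mem hn
  rw [h1] at h2
  exact e.map_eq_zero_iff.1 h2

/-! ### Disjoint unions of diagrams -/

namespace QuadraticQuiver

namespace Diagram

section Sigma

variable {Q : QuadraticQuiver} {ι : Type} [Fintype ι] (D : ι → Q.Diagram)

/-- The disjoint union of diagrams. -/
def sigma : Q.Diagram where
  X := Σ i, (D i).X
  Y := Σ i, (D i).Y
  tail y := ⟨y.1, (D y.1).tail y.2⟩
  head y := ⟨y.1, (D y.1).head y.2⟩
  vert x := (D x.1).vert x.2
  lab y := (D y.1).lab y.2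
  src_lab y := (D y.1).src_lab y.2
  tgt_lab y := (D y.1).tgt_lab y.2
  norel := by
    rintro ⟨i, y⟩ ⟨j, z⟩ h
    obtain rfl : i = j := congrArg Sigma.fst h
    exact (D i).norel y z (eq_of_heq (Sigma.mk.inj h).2)

variable {D}

lemma sigma_inInjective (h : ∀ i, (D i).InInjective) : (sigma D).InInjective := by
  rintro ⟨i, y⟩ ⟨j, z⟩ e1 e2
  obtain rfl : i = j := congrArg Sigma.fst e1
  rw [h i y z (eq_of_heq (Sigma.mk.inj e1).2) e2]

lemma sigma_outInjective (h : ∀ i, (D i).OutInjective) : (sigma D).OutInjective := by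
  rintro ⟨i, y⟩ ⟨j, z⟩ e1 e2
  obtain rfl : i = j := congrArg Sigma.fst e1
  rw [h i y z (eq_of_heq (Sigma.mk.inj e1).2) e2]

/-- A disjoint union of trees of projective type is a forest of projective type. -/
def ProjForest.sigma (F : ∀ i, (D i).ProjForest Unit) : (sigma D).ProjForest ι where
  root i := ⟨i, (F i).root ()⟩
  comp x := x.1
  depth x := (F x.1).depth x.2
  comp_head _ := rfl
  depth_head y := (F y.1).depth_head y.2
  depth_root i := (F i).depth_root ()
  comp_root _ := rfl
  root_comp := by
    rintro ⟨i, x⟩ h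
    change (⟨i, (F i).root ((F i).comp x)⟩ : Σ i, (D i).X) = _
    rw [(F i).root_comp x h]
  exists_parent := by
    rintro ⟨i, x⟩ h
    obtain ⟨y, rfl⟩ := (F i).exists_parent x h
    exact ⟨⟨i, y⟩, rfl⟩
  head_injective := by
    rintro ⟨i, y⟩ ⟨j, z⟩ e1
    obtain rfl : i = j := congrArg Sigma.fst e1
    exact congrArg (Sigma.mk i) ((F i).head_injective (eq_of_heq (Sigma.mk.inj e1).2))
  outInjective := sigma_outInjective fun i => (F i).outInjective
  exists_child := by
    rintro ⟨i, x⟩ α h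
    rcases (F i).exists_child x α h with ⟨y, rfl, h'⟩ | ⟨y, rfl, h'⟩
    · exact Or.inl ⟨⟨i, y⟩, rfl, h'⟩
    · exact Or.inr ⟨⟨i, y⟩, rfl, h'⟩

/-- A disjoint union of trees of injective type is a forest of injective type. -/
def InjForest.sigma (F : ∀ i, (D i).InjForest Unit) : (sigma D).InjForest ι where
  root i := ⟨i, (F i).root ()⟩
  comp x := x.1
  depth x := (F x.1).depth x.2
  comp_tail _ := rfl
  depth_tail y := (F y.1).depth_tail y.2
  depth_root i := (F i).depth_root ()
  comp_root _ := rfl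
  root_comp := by
    rintro ⟨i, x⟩ h
    change (⟨i, (F i).root ((F i).comp x)⟩ : Σ i, (D i).X) = _
    rw [(F i).root_comp x h]
  exists_parent := by
    rintro ⟨i, x⟩ h
    obtain ⟨y, rfl⟩ := (F i).exists_parent x h
    exact ⟨⟨i, y⟩, rfl⟩
  tail_injective := by
    rintro ⟨i, y⟩ ⟨j, z⟩ e1
    obtain rfl : i = j := congrArg Sigma.fst e1
    exact congrArg (Sigma.mk i) ((F i).tail_injective (eq_of_heq (Sigma.mk.inj e1).2))
  inInjective := sigma_inInjective fun i => (F i).inInjective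
  exists_child := by
    rintro ⟨i, x⟩ α h
    rcases (F i).exists_child x α h with ⟨y, rfl, h'⟩ | ⟨y, rfl, h'⟩
    · exact Or.inl ⟨⟨i, y⟩, rfl, h'⟩
    · exact Or.inr ⟨⟨i, y⟩, rfl, h'⟩

variable {k : Type*} [Field k] {κ : Type*} [Fintype κ] {V : Type*} [AddCommGroup V] [Module k V]

/-- The comparison of the two descriptions of the direct sum, as a `k`-linear map. -/
noncomputable def sigmaEquivAux (b : Module.Basis κ k V) :
    (∀ i, κ → (D i).Free k k) →ₗ[k] (sigma D).Free k V where
  toFun f x := b.equivFun.symm fun l => f x.1 l x.2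
  map_add' f f' := by
    funext x
    exact map_add b.equivFun.symm (fun l => f x.1 l x.2) (fun l => f' x.1 l x.2)
  map_smul' c f := by
    funext x
    exact map_smul b.equivFun.symm c (fun l => f x.1 l x.2)

/-- The module of a disjoint union, with coefficients in `V`, is the direct sum of `dim V` copies
of the modules of the components. -/
noncomputable def sigmaEquiv (hD : ∀ i, (D i).InInjective) (b : Module.Basis κ k V) :
    (∀ i, κ → (D i).Free k k) ≃ₗ[(Q.Alg k)ᵐᵒᵖ] (sigma D).Free k V :=
  LinearEquiv.ofBijective
    { sigmaEquivAux b with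
      map_smul' := by
        classical
        refine map_smul_of_generators (sigmaEquivAux b) ?_ ?_
        · intro v f
          funext x
          rw [idem_smul_apply]
          change (b.equivFun.symm fun l => (idem k v • f x.1 l : (D x.1).Free k k) x.2) =
            if (D x.1).vert x.2 = v then b.equivFun.symm fun l => f x.1 l x.2 else 0
          simp only [idem_smul_apply]
          split_ifs with h
          · rfl
          · exact map_zero b.equivFun.symm
        · intro α f
          funext x
          obtain ⟨i, x⟩ := x
          change (b.equivFun.symm fun l => (arr k α • f i l : (D i).Free k k) x) = _
          by_cases h : ∃ y, (D i).head y = x ∧ (D i).lab y = α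
          · obtain ⟨y, rfl, rfl⟩ := h
            -- On both sides a single arrow contributes at its head, so the actions agree summand by
            -- summand.
            simp only [(hD i).arr_smul_apply]
            exact ((sigma_inInjective hD).arr_smul_apply (fun _ => LinearEquiv.refl k V)
              ⟨i, y⟩ (sigmaEquivAux b f)).symm
          · have h' : ∀ l, (arr k α • f i l : (D i).Free k k) x = 0 := fun l =>
              arr_smul_apply_of_forall_ne _ _ _ _ _ fun y h1 h2 => h ⟨y, h1, h2⟩
            simp only [h']
            refine (map_zero b.equivFun.symm).trans (Eq.symm ?_)
            refine arr_smul_apply_of_forall_ne (sigma D) _ _ _ _ ?_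
            rintro ⟨j, y⟩ h1 h2
            obtain rfl : j = i := congrArg Sigma.fst h1
            exact h ⟨y, eq_of_heq (Sigma.mk.inj h1).2, h2⟩ }
    (by
      constructor
      · intro f f' h
        funext i l x
        exact congrFun (b.equivFun.symm.injective (congrFun h ⟨i, x⟩)) l
      · intro f
        refine ⟨fun i l x => b.equivFun (f ⟨i, x⟩) l, ?_⟩
        funext x
        exact b.equivFun.symm_apply_apply (f x))

end Sigma

end Diagram

end QuadraticQuiver

/-! ### Diagrams of strings and of cyclic strings -/

namespace QuadraticQuiver

section Strings

variable {Q : QuadraticQuiver}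

namespace Str

variable (s : Q.Str)

lemma tail_of_direct {i : Fin s.n} (h : s.direct i) : s.diagram.tail i = i.castSucc := if_pos h

lemma head_of_direct {i : Fin s.n} (h : s.direct i) : s.diagram.head i = i.succ := if_pos h

lemma tail_of_not_direct {i : Fin s.n} (h : ¬ s.direct i) : s.diagram.tail i = i.succ := if_neg h

lemma head_of_not_direct {i : Fin s.n} (h : ¬ s.direct i) : s.diagram.head i = i.castSucc :=
  if_neg h

/-- Two distinct letters leaving the same vertex are adjacent and of opposite direction; with equal
labels they would cancel, against reducedness. -/
lemma diagram_outInjective : s.diagram.OutInjective := by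
  intro (i : Fin s.n) (j : Fin s.n) e (e' : s.arrow i = s.arrow j)
  by_cases hi : s.direct i <;> by_cases hj : s.direct j
  · rw [s.tail_of_direct hi, s.tail_of_direct hj] at e
    exact Fin.castSucc_injective _ e
  · rw [s.tail_of_direct hi, s.tail_of_not_direct hj] at e
    exact absurd ((s.reduced j i (congrArg Fin.val e).symm e'.symm).2 hi) hj
  · rw [s.tail_of_not_direct hi, s.tail_of_direct hj] at e
    exact absurd ((s.reduced i j (congrArg Fin.val e) e').2 hj) hi
  · rw [s.tail_of_not_direct hi, s.tail_of_not_direct hj] at e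
    exact Fin.succ_injective _ e

lemma diagram_inInjective : s.diagram.InInjective := by
  intro (i : Fin s.n) (j : Fin s.n) e (e' : s.arrow i = s.arrow j)
  by_cases hi : s.direct i <;> by_cases hj : s.direct j
  · rw [s.head_of_direct hi, s.head_of_direct hj] at e
    exact Fin.succ_injective _ e
  · rw [s.head_of_direct hi, s.head_of_not_direct hj] at e
    exact absurd ((s.reduced i j (congrArg Fin.val e) e').1 hi) hj
  · rw [s.head_of_not_direct hi, s.head_of_direct hj] at e
    exact absurd ((s.reduced j i (congrArg Fin.val e).symm e'.symm).1 hj) hi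
  · rw [s.head_of_not_direct hi, s.head_of_not_direct hj] at e
    exact Fin.castSucc_injective _ e

end Str

namespace CyclicStr

variable (b : Q.CyclicStr)

lemma tail_of_direct {i : ZMod b.n} (h : b.direct i) : b.diagram.tail i = i := if_pos h

lemma head_of_direct {i : ZMod b.n} (h : b.direct i) : b.diagram.head i = i + 1 := if_pos h

lemma tail_of_not_direct {i : ZMod b.n} (h : ¬ b.direct i) : b.diagram.tail i = i + 1 := if_neg h

lemma head_of_not_direct {i : ZMod b.n} (h : ¬ b.direct i) : b.diagram.head i = i := if_neg h

/-- As for strings, two distinct letters with a common tail are cyclically adjacent and of opposite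
direction, so `reduced` forbids equal labels. -/
lemma diagram_outInjective : b.diagram.OutInjective := by
  intro (i : ZMod b.n) (j : ZMod b.n) e (e' : b.arrow i = b.arrow j)
  by_cases hi : b.direct i <;> by_cases hj : b.direct j
  · rwa [b.tail_of_direct hi, b.tail_of_direct hj] at e
  · rw [b.tail_of_direct hi, b.tail_of_not_direct hj] at e
    subst e
    exact absurd ((b.reduced j e'.symm).2 hi) hj
  · rw [b.tail_of_not_direct hi, b.tail_of_direct hj] at e
    subst e
    exact absurd ((b.reduced i e').2 hj) hi
  · rw [b.tail_of_not_direct hi, b.tail_of_not_direct hj] at e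
    exact add_right_cancel (G := ZMod b.n) e

lemma diagram_inInjective : b.diagram.InInjective := by
  intro (i : ZMod b.n) (j : ZMod b.n) e (e' : b.arrow i = b.arrow j)
  by_cases hi : b.direct i <;> by_cases hj : b.direct j
  · rw [b.head_of_direct hi, b.head_of_direct hj] at e
    exact add_right_cancel (G := ZMod b.n) e
  · rw [b.head_of_direct hi, b.head_of_not_direct hj] at e
    subst e
    exact absurd ((b.reduced i e').1 hi) hj
  · rw [b.head_of_not_direct hi, b.head_of_direct hj] at e
    subst e
    exact absurd ((b.reduced j e'.symm).1 hj) hi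
  · rwa [b.head_of_not_direct hi, b.head_of_not_direct hj] at e

end CyclicStr

end Strings

end QuadraticQuiver

/-! ### Turning about the marked points -/

namespace PolygonGluing

variable {S : PolygonGluing}

lemma flip_flip_side (h : S.Side) : flip (flip h) = h := by
  simp [flip]

lemma next_injective : Function.Injective (next : S.Side → S.Side) := by
  rintro ⟨j, i⟩ ⟨j', i'⟩ h
  obtain rfl : j = j' := congrArg Sigma.fst h
  exact congrArg (Sigma.mk j) (add_right_cancel (eq_of_heq (Sigma.mk.inj h).2))

/-- An arc has exactly two sides. This is the gentle condition in combinatorial form: at most two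
arrows start, and at most two end, at each arc. -/
lemma eq_or_eq_flip_of_arcOf_eq {h h' : S.Side} (e : arcOf h = arcOf h') :
    h = h' ∨ h = flip h' := by
  by_cases e2 : (S.glue h).2 = (S.glue h').2
  · exact Or.inl (S.glue.injective (Prod.ext e e2))
  · right
    apply S.glue.injective
    refine Prod.ext ?_ ?_
    · exact e.trans (arcOf_flip h').symm
    · simpa [flip] using Bool.eq_not_of_ne e2

lemma hasPrev_next_iff (h : S.Side) : HasPrev (next h) ↔ HasNext h := by
  simp only [HasPrev, HasNext, next, Ne, eq_neg_iff_add_eq_zero]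
  exact Iff.rfl

end PolygonGluing

namespace MarkedRibbonSurface

open PolygonGluing Set QuadraticQuiver

section Turning

variable {S : MarkedRibbonSurface}

/-- The number of arcs met on turning counterclockwise about an endpoint of an arc, up to the
boundary. -/
noncomputable def rank (h : S.Side) : ℕ :=
  open Classical in Nat.find (S.marked_boundary h)

/-- `flip (next h)` is one turn further about the same endpoint, so the least number of turns to the
boundary drops by one. -/
lemma rank_eq_succ {h : S.Side} (hn : HasNext h) : rank h = rank (flip (next h)) + 1 := by
  classical
  have hs := Nat.find_spec (S.marked_boundary h)
  have h0 : rank h ≠ 0 := by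
    intro e
    rw [rank] at e
    rw [e] at hs
    exact hs hn
  obtain ⟨m, hm⟩ := Nat.exists_eq_succ_of_ne_zero h0
  rw [hm, Nat.succ_eq_add_one, Nat.add_right_cancel_iff]
  apply le_antisymm
  · refine Nat.le_of_succ_le_succ (le_of_eq_of_le hm.symm ?_)
    exact Nat.find_min' _ (by
      rw [Function.iterate_succ_apply]
      exact Nat.find_spec (S.marked_boundary (flip (next h))))
  · refine Nat.find_min' _ ?_
    change Nat.find (S.marked_boundary h) = m + 1 at hm
    rwa [hm, Function.iterate_succ_apply] at hs

/-- Composability puts `β.1` on the arc of `next α.1`. Being that very side is the relation, so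
otherwise `β.1` is the opposite side and the turn about the same endpoint continues. This bounds the
length of nonzero paths. -/
lemma rank_lt_of_not_rel {α β : S.quiver.E} (h : S.quiver.tgt α = S.quiver.src β)
    (hr : ¬ S.quiver.rel α β) : rank β.1 < rank α.1 := by
  have e : β.1 = flip (next α.1) :=
    (eq_or_eq_flip_of_arcOf_eq (h' := next α.1) h.symm).resolve_left hr
  rw [rank_eq_succ α.2, e]
  exact Nat.lt_succ_self _

instance : Finite S.Side := Finite.of_equiv _ S.glue.symm

/-- Every vertex of a diagram is reached from vertices at which no arrow ends. -/
lemma induction_from_tops (D : S.quiver.Diagram) {p : D.X → Prop}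
    (h1 : ∀ x, (∀ y, D.head y ≠ x) → p x) (h2 : ∀ y, p (D.tail y) → p (D.head y)) (x : D.X) :
    p x := by
  obtain ⟨B, hB⟩ := (Set.finite_range (rank : S.Side → ℕ)).bddAbove
  -- Walking backwards along arrows raises the rank, which is bounded by `B`; `d` is the remaining
  -- room. With `d = 0` no arrow can end at `D.tail y`.
  have key : ∀ d y, B ≤ rank (D.lab y).1 + d → p (D.tail y) := by
    intro d
    induction d with
    | zero =>
      intro y hy
      refine h1 _ fun z hz => ?_
      have := rank_lt_of_not_rel (α := D.lab z) (β := D.lab y)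
        (by rw [D.tgt_lab, hz, D.src_lab]) (D.norel z y hz)
      have := hB ⟨(D.lab z).1, rfl⟩
      omega
    | succ d ih =>
      intro y hy
      by_cases h : ∃ z, D.head z = D.tail y
      · obtain ⟨z, hz⟩ := h
        have := rank_lt_of_not_rel (α := D.lab z) (β := D.lab y)
          (by rw [D.tgt_lab, hz, D.src_lab]) (D.norel z y hz)
        rw [← hz]
        exact h2 z (ih z (by omega))
      · exact h1 _ fun z hz => h ⟨z, hz⟩
  by_cases h : ∃ y, D.head y = x
  · obtain ⟨y, rfl⟩ := h
    exact h2 y (key B y (by omega))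
  · exact h1 x fun y hy => h ⟨y, hy⟩

/-- Every vertex of a diagram leads to vertices at which no arrow starts. -/
lemma induction_from_socles (D : S.quiver.Diagram) {p : D.X → Prop}
    (h1 : ∀ x, (∀ y, D.tail y ≠ x) → p x) (h2 : ∀ y, p (D.head y) → p (D.tail y)) (x : D.X) :
    p x := by
  -- Walking forwards lowers the rank, which is bounded below by zero.
  have key : ∀ d y, rank (D.lab y).1 ≤ d → p (D.head y) := by
    intro d
    induction d with
    | zero =>
      intro y hy
      refine h1 _ fun z hz => ?_
      have := rank_lt_of_not_rel (α := D.lab y) (β := D.lab z)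
        (by rw [D.tgt_lab, ← hz, D.src_lab]) (D.norel y z hz.symm)
      omega
    | succ d ih =>
      intro y hy
      by_cases h : ∃ z, D.tail z = D.head y
      · obtain ⟨z, hz⟩ := h
        have := rank_lt_of_not_rel (α := D.lab y) (β := D.lab z)
          (by rw [D.tgt_lab, ← hz, D.src_lab]) (D.norel y z hz.symm)
        rw [← hz]
        exact h2 z (ih z (by omega))
      · exact h1 _ fun z hz => h ⟨z, hz⟩
  by_cases h : ∃ y, D.tail y = x
  · obtain ⟨y, rfl⟩ := h
    exact h2 y (key _ y le_rfl)
  · exact h1 x fun y hy => h ⟨y, hy⟩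

end Turning

/-! ### Projective and injective curves give trees -/

namespace PermissibleCurve

variable {S : MarkedRibbonSurface} (c : S.PermissibleCurve)

variable {c} in
lemma IsRight.not_isLeft {i : ℕ} (h : c.IsRight i) : ¬ c.IsLeft i := by
  unfold IsRight at h
  unfold IsLeft
  omega

/-- The arrow `α` starts from one of the two sides of the arc crossed at `x`, so it lives in the
polygon that `c` leaves or in the one it enters. In an end polygon this is excluded by maximality.
In a middle polygon the triangle cut off by `c` either gives `α` itself or an arrow arriving at the
side of `α`, which is the relation. -/
lemma exists_child_of_maximal (h0 : ¬ HasNext (sideAt (c.poly 0) (c.exit 0)))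
    (hn : ¬ HasNext (sideAt (c.poly (c.n + 1)) (c.entry (c.n + 1)))) (x : c.str.diagram.X)
    (α : S.quiver.E) (hs : S.quiver.src α = c.str.diagram.vert x) :
    (∃ y, c.str.diagram.tail y = x ∧ c.str.diagram.lab y = α) ∨
      ∃ y, c.str.diagram.head y = x ∧ S.quiver.rel (c.str.diagram.lab y) α := by
  obtain ⟨x, hx⟩ := x
  change x < c.n + 1 at hx
  rcases eq_or_eq_flip_of_arcOf_eq (h := α.1) hs with e | e
  · rcases x with _ | x
    · exact absurd (e ▸ α.2) h0
    · have hx' : x + 1 ≤ c.n := by omega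
      by_cases h : c.IsLeft (x + 1)
      · refine Or.inr ⟨(⟨x, hx'⟩ : Fin c.n), c.str.head_of_direct h, ?_⟩
        exact e.trans (c.next_arrow_left hx' h).symm
      · refine Or.inl ⟨(⟨x, hx'⟩ : Fin c.n), c.str.tail_of_not_direct h, ?_⟩
        exact Subtype.ext ((c.arrow_right hx' h).trans e.symm)
  · rw [← c.cross x (by omega)] at e
    rcases Nat.lt_or_ge x c.n with hx' | hx'
    · by_cases h : c.IsLeft (x + 1)
      · refine Or.inl ⟨(⟨x, hx'⟩ : Fin c.n), c.str.tail_of_direct h, ?_⟩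
        exact Subtype.ext ((c.arrow_left hx' h).trans e.symm)
      · refine Or.inr ⟨(⟨x, hx'⟩ : Fin c.n), c.str.head_of_not_direct h, ?_⟩
        exact e.trans (c.next_arrow_right hx' h).symm
    · obtain rfl : x = c.n := by omega
      exact absurd (e ▸ α.2) hn

/-- The dual case analysis, on the side `next α.1` at which `α` ends. That side has a predecessor,
which excludes the end polygons; `next_injective` recovers the arrow from its final side. -/
lemma exists_child_of_comaximal (h0 : ¬ HasPrev (sideAt (c.poly 0) (c.exit 0)))
    (hn : ¬ HasPrev (sideAt (c.poly (c.n + 1)) (c.entry (c.n + 1)))) (x : c.str.diagram.X)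
    (α : S.quiver.E) (hs : S.quiver.tgt α = c.str.diagram.vert x) :
    (∃ y, c.str.diagram.head y = x ∧ c.str.diagram.lab y = α) ∨
      ∃ y, c.str.diagram.tail y = x ∧ S.quiver.rel α (c.str.diagram.lab y) := by
  obtain ⟨x, hx⟩ := x
  change x < c.n + 1 at hx
  have hα := (hasPrev_next_iff α.1).2 α.2
  rcases eq_or_eq_flip_of_arcOf_eq (h := next α.1) hs with e | e
  · rcases x with _ | x
    · exact absurd (e ▸ hα) h0
    · have hx' : x + 1 ≤ c.n := by omega
      by_cases h : c.IsLeft (x + 1)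
      · refine Or.inl ⟨(⟨x, hx'⟩ : Fin c.n), c.str.head_of_direct h, ?_⟩
        exact Subtype.ext (next_injective ((c.next_arrow_left hx' h).trans e.symm))
      · refine Or.inr ⟨(⟨x, hx'⟩ : Fin c.n), c.str.tail_of_not_direct h, ?_⟩
        exact (c.arrow_right hx' h).trans e.symm
  · rw [← c.cross x (by omega)] at e
    rcases Nat.lt_or_ge x c.n with hx' | hx'
    · by_cases h : c.IsLeft (x + 1)
      · refine Or.inr ⟨(⟨x, hx'⟩ : Fin c.n), c.str.tail_of_direct h, ?_⟩
        exact (c.arrow_left hx' h).trans e.symm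
      · refine Or.inl ⟨(⟨x, hx'⟩ : Fin c.n), c.str.head_of_not_direct h, ?_⟩
        exact Subtype.ext (next_injective ((c.next_arrow_right hx' h).trans e.symm))
    · obtain rfl : x = c.n := by omega
      exact absurd (e ▸ hα) hn

variable {c}

/-- The diagram of a projective permissible curve is a tree of projective type. -/
noncomputable def IsProjective.forest {γ : S.Arc} (h : c.IsProjective γ) :
    c.str.diagram.ProjForest Unit :=
  have hi := h.choose_spec.1
  have hR : ∀ a, a + 1 ≤ h.choose → ¬ c.IsLeft (a + 1) := fun a ha =>
    (h.choose_spec.2.2.1.choose_spec (a + 1) (by omega) ha).1.not_isLeft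
  have hL : ∀ a, h.choose ≤ a → a + 1 ≤ c.n → c.IsLeft (a + 1) := fun a ha ha' =>
    (h.choose_spec.2.2.2.1.choose_spec (a + 1) (by omega) ha').1
  { root := fun _ => (⟨h.choose, Nat.lt_succ_of_le hi⟩ : Fin (c.n + 1))
    comp := fun _ => ()
    -- The distance to the root index: with truncated subtraction one of the two summands is always
    -- zero.
    depth := fun x : Fin (c.n + 1) => (x.val - h.choose) + (h.choose - x.val)
    comp_head := fun _ => rfl
    depth_head := by
      intro (y : Fin c.n)
      rcases Nat.lt_or_ge y.val h.choose with hy | hy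
      · rw [c.str.head_of_not_direct (hR y hy), c.str.tail_of_not_direct (hR y hy)]
        change y.val - h.choose + (h.choose - y.val) =
          y.val + 1 - h.choose + (h.choose - (y.val + 1)) + 1
        omega
      · rw [c.str.head_of_direct (hL y hy y.2), c.str.tail_of_direct (hL y hy y.2)]
        change y.val + 1 - h.choose + (h.choose - (y.val + 1)) =
          y.val - h.choose + (h.choose - y.val) + 1
        omega
    depth_root := fun _ => by simp
    comp_root := fun _ => rfl
    root_comp := fun x hx => Fin.ext (by simp only at hx ⊢; omega)
    exists_parent := by
      rintro ⟨x, hx⟩ hne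
      change x < c.n + 1 at hx
      simp only at hne
      rcases Nat.lt_or_ge x h.choose with hy | hy
      · exact ⟨(⟨x, by omega⟩ : Fin c.n), c.str.head_of_not_direct (hR x hy)⟩
      · obtain ⟨x, rfl⟩ := Nat.exists_eq_succ_of_ne_zero (show x ≠ 0 by omega)
        exact ⟨(⟨x, by omega⟩ : Fin c.n),
          c.str.head_of_direct (hL x (by omega) (by omega))⟩
    head_injective := by
      intro (y : Fin c.n) (z : Fin c.n) e
      rcases Nat.lt_or_ge y.val h.choose with hy | hy <;>
        rcases Nat.lt_or_ge z.val h.choose with hz | hz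
      · rw [c.str.head_of_not_direct (hR y hy), c.str.head_of_not_direct (hR z hz)] at e
        exact Fin.castSucc_injective _ e
      · rw [c.str.head_of_not_direct (hR y hy), c.str.head_of_direct (hL z hz z.2)] at e
        have : y.val = z.val + 1 := congrArg Fin.val e
        omega
      · rw [c.str.head_of_direct (hL y hy y.2), c.str.head_of_not_direct (hR z hz)] at e
        have : y.val + 1 = z.val := congrArg Fin.val e
        omega
      · rw [c.str.head_of_direct (hL y hy y.2), c.str.head_of_direct (hL z hz z.2)] at e
        exact Fin.succ_injective _ e
    outInjective := c.str.diagram_outInjective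
    exists_child := c.exists_child_of_maximal h.choose_spec.2.2.2.2.1 h.choose_spec.2.2.2.2.2 }

lemma IsProjective.vert_root {γ : S.Arc} (h : c.IsProjective γ) :
    c.str.diagram.vert (h.forest.root ()) = γ := h.choose_spec.2.1

/-- The diagram of an injective permissible curve is a tree of injective type. -/
noncomputable def IsInjective.forest {γ : S.Arc} (h : c.IsInjective γ) :
    c.str.diagram.InjForest Unit :=
  have hi := h.choose_spec.1
  have hL : ∀ a, a + 1 ≤ h.choose → c.IsLeft (a + 1) := fun a ha =>
    (h.choose_spec.2.2.1.choose_spec (a + 1) (by omega) ha).1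
  have hR : ∀ a, h.choose ≤ a → a + 1 ≤ c.n → ¬ c.IsLeft (a + 1) := fun a ha ha' =>
    (h.choose_spec.2.2.2.1.choose_spec (a + 1) (by omega) ha').1.not_isLeft
  { root := fun _ => (⟨h.choose, Nat.lt_succ_of_le hi⟩ : Fin (c.n + 1))
    comp := fun _ => ()
    depth := fun x : Fin (c.n + 1) => (x.val - h.choose) + (h.choose - x.val)
    comp_tail := fun _ => rfl
    depth_tail := by
      intro (y : Fin c.n)
      rcases Nat.lt_or_ge y.val h.choose with hy | hy
      · rw [c.str.head_of_direct (hL y hy), c.str.tail_of_direct (hL y hy)]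
        change y.val - h.choose + (h.choose - y.val) =
          y.val + 1 - h.choose + (h.choose - (y.val + 1)) + 1
        omega
      · rw [c.str.head_of_not_direct (hR y hy y.2), c.str.tail_of_not_direct (hR y hy y.2)]
        change y.val + 1 - h.choose + (h.choose - (y.val + 1)) =
          y.val - h.choose + (h.choose - y.val) + 1
        omega
    depth_root := fun _ => by simp
    comp_root := fun _ => rfl
    root_comp := fun x hx => Fin.ext (by simp only at hx ⊢; omega)
    exists_parent := by
      rintro ⟨x, hx⟩ hne
      change x < c.n + 1 at hx
      simp only at hne
      rcases Nat.lt_or_ge x h.choose with hy | hy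
      · exact ⟨(⟨x, by omega⟩ : Fin c.n), c.str.tail_of_direct (hL x hy)⟩
      · obtain ⟨x, rfl⟩ := Nat.exists_eq_succ_of_ne_zero (show x ≠ 0 by omega)
        exact ⟨(⟨x, by omega⟩ : Fin c.n),
          c.str.tail_of_not_direct (hR x (by omega) (by omega))⟩
    tail_injective := by
      intro (y : Fin c.n) (z : Fin c.n) e
      rcases Nat.lt_or_ge y.val h.choose with hy | hy <;>
        rcases Nat.lt_or_ge z.val h.choose with hz | hz
      · rw [c.str.tail_of_direct (hL y hy), c.str.tail_of_direct (hL z hz)] at e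
        exact Fin.castSucc_injective _ e
      · rw [c.str.tail_of_direct (hL y hy), c.str.tail_of_not_direct (hR z hz z.2)] at e
        have : y.val = z.val + 1 := congrArg Fin.val e
        omega
      · rw [c.str.tail_of_not_direct (hR y hy y.2), c.str.tail_of_direct (hL z hz)] at e
        have : y.val + 1 = z.val := congrArg Fin.val e
        omega
      · rw [c.str.tail_of_not_direct (hR y hy y.2), c.str.tail_of_not_direct (hR z hz z.2)] at e
        exact Fin.succ_injective _ e
    inInjective := c.str.diagram_inInjective
    exists_child := c.exists_child_of_comaximal h.choose_spec.2.2.2.2.1 h.choose_spec.2.2.2.2.2 }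

lemma IsInjective.vert_root {γ : S.Arc} (h : c.IsInjective γ) :
    c.str.diagram.vert (h.forest.root ()) = γ := h.choose_spec.2.1

end PermissibleCurve

end MarkedRibbonSurface

/-! ### Projective covers and injective envelopes of diagram modules -/

namespace MarkedRibbonSurface

open PolygonGluing Set QuadraticQuiver

section Covers

variable {S : MarkedRibbonSurface} {k : Type*} [Field k] {κ : Type*} [Fintype κ] {V : Type*}
  [AddCommGroup V] [Module k V] {D : S.quiver.Diagram} (θ : D.Y → (V ≃ₗ[k] V)) {T : Type}
  {p : T → S.PermissibleCurve}

/-- By `htop` and `hall` the family `top` lists exactly the vertices at which no arrow ends, and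
`induction_from_tops` shows that they generate. Serves strings, with a one-element basis of `k`, and
bands, with a basis of `V`. -/
theorem isProjectiveCover_pi (b : Module.Basis κ k V) (top : T → D.X)
    (hp : ∀ t, (p t).IsProjective (D.vert (top t))) (hinj : Function.Injective top)
    (htop : ∀ t y, D.head y ≠ top t) (hall : ∀ x, (∀ y, D.head y ≠ x) → ∃ t, top t = x)
    (hout : D.OutInjective) :
    IsProjectiveCover (S.Alg k)ᵐᵒᵖ (∀ t, κ → (p t).Mod k) (D.Mod k V θ) := by
  have : Finite T := Finite.of_injective top hinj
  have := Fintype.ofFinite T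
  refine IsProjectiveCover.of_equiv ?_
    (Diagram.sigmaEquiv (fun t => (p t).str.diagram_inInjective) b)
  refine (Diagram.ProjForest.sigma fun t => (hp t).forest).isProjectiveCover θ top hinj
    (fun t => (hp t).vert_root) htop hout fun q h1 h2 => induction_from_tops D (fun x hx => ?_) h2
  obtain ⟨t, rfl⟩ := hall x hx
  exact h1 t

/-- The isomorphism `e` is taken as an argument so that Baer's criterion is turned into injectivity
only once, for the final module `E`. -/
theorem isInjectiveEnvelope_pi (b : Module.Basis κ k V) (soc : T → D.X)
    (hp : ∀ t, (p t).IsInjective (D.vert (soc t))) (hinj : Function.Injective soc)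
    (hsoc : ∀ t y, D.tail y ≠ soc t) (hall : ∀ x, (∀ y, D.tail y ≠ x) → ∃ t, soc t = x)
    (hin : D.InInjective) {E : Type*} [AddCommGroup E] [Module (S.Alg k)ᵐᵒᵖ E]
    (e : E ≃ₗ[(S.Alg k)ᵐᵒᵖ] ∀ t, κ → (p t).Mod k) :
    IsInjectiveEnvelope (S.Alg k)ᵐᵒᵖ E (D.Mod k V θ) := by
  have : Finite T := Finite.of_injective soc hinj
  have := Fintype.ofFinite T
  let F := Diagram.InjForest.sigma fun t => (hp t).forest
  refine IsInjectiveEnvelope.of_equiv F.baer ?_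
    (e.trans (Diagram.sigmaEquiv (fun t => (p t).str.diagram_inInjective) b))
  refine F.exists_essential θ soc hinj (fun t => (hp t).vert_root) hsoc hin fun q h1 h2 =>
    induction_from_socles D (fun x hx => ?_) h2
  obtain ⟨t, rfl⟩ := hall x hx
  exact h1 t

/-- A finite direct sum as a product. -/
noncomputable def directSumEquivPi {R : Type*} [Ring R] [Finite T] (M : T → Type*)
    [∀ t, AddCommGroup (M t)] [∀ t, Module R (M t)] : DirectSum T M ≃ₗ[R] ∀ t, M t :=
  haveI := Fintype.ofFinite T
  DirectSum.linearEquivFunOnFintype R T M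

end Covers

/-! ### Tops and socles of string and band modules -/

namespace PermissibleCurve

variable {S : MarkedRibbonSurface} (c : S.PermissibleCurve)

/-- At such an index the preceding letter is inverse and the following one direct, so both point
away from it. At an end of the string one of them is missing, which is why the condition is void
there. -/
lemma head_ne_of_topIndex (t : c.TopIndex) (y : c.str.diagram.Y) :
    c.str.diagram.head y ≠ t.1 := by
  obtain ⟨⟨t, ht⟩, h1, h2⟩ := t
  obtain ⟨y, hy⟩ := y
  change y < c.n at hy
  intro e
  by_cases h : c.IsLeft (y + 1)
  · rw [c.str.head_of_direct (i := ⟨y, hy⟩) h] at e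
    obtain rfl : y + 1 = t := congrArg Fin.val e
    exact (h1 (Nat.le_add_left _ _)).not_isLeft h
  · rw [c.str.head_of_not_direct (i := ⟨y, hy⟩) h] at e
    obtain rfl : y = t := congrArg Fin.val e
    exact h (h2 hy)

lemma exists_topIndex (x : c.str.diagram.X) (hx : ∀ y, c.str.diagram.head y ≠ x) :
    ∃ t : c.TopIndex, t.1 = x := by
  obtain ⟨x, hxn⟩ := x
  change x < c.n + 1 at hxn
  refine ⟨⟨⟨x, hxn⟩, fun h => ?_, fun h => ?_⟩, rfl⟩
  · obtain ⟨x, rfl⟩ := Nat.exists_eq_add_of_le' h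
    have h' : x < c.n := by omega
    refine c.isRight_of_not h h' fun hl => ?_
    exact hx (⟨x, h'⟩ : Fin c.n) (c.str.head_of_direct (i := ⟨x, h'⟩) hl)
  · by_contra hl
    exact hx (⟨x, h⟩ : Fin c.n) (c.str.head_of_not_direct (i := ⟨x, h⟩) hl)

lemma tail_ne_of_socIndex (t : c.SocIndex) (y : c.str.diagram.Y) :
    c.str.diagram.tail y ≠ t.1 := by
  obtain ⟨⟨t, ht⟩, h1, h2⟩ := t
  obtain ⟨y, hy⟩ := y
  change y < c.n at hy
  intro e
  by_cases h : c.IsLeft (y + 1)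
  · rw [c.str.tail_of_direct (i := ⟨y, hy⟩) h] at e
    obtain rfl : y = t := congrArg Fin.val e
    exact (h2 hy).not_isLeft h
  · rw [c.str.tail_of_not_direct (i := ⟨y, hy⟩) h] at e
    obtain rfl : y + 1 = t := congrArg Fin.val e
    exact h (h1 (Nat.le_add_left _ _))

lemma exists_socIndex (x : c.str.diagram.X) (hx : ∀ y, c.str.diagram.tail y ≠ x) :
    ∃ t : c.SocIndex, t.1 = x := by
  obtain ⟨x, hxn⟩ := x
  change x < c.n + 1 at hxn
  refine ⟨⟨⟨x, hxn⟩, fun h => ?_, fun h => ?_⟩, rfl⟩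
  · obtain ⟨x, rfl⟩ := Nat.exists_eq_add_of_le' h
    have h' : x < c.n := by omega
    by_contra hl
    exact hx (⟨x, h'⟩ : Fin c.n) (c.str.tail_of_not_direct (i := ⟨x, h'⟩) hl)
  · refine c.isRight_of_not (by omega) h fun hl => ?_
    exact hx (⟨x, h⟩ : Fin c.n) (c.str.tail_of_direct (i := ⟨x, h⟩) hl)

variable (k : Type*) [Field k]

instance : Finite c.TopIndex := inferInstanceAs (Finite {_i : Fin (c.n + 1) // _})

instance : Finite c.SocIndex := inferInstanceAs (Finite {_i : Fin (c.n + 1) // _})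

/-- The projective cover of a string module. -/
theorem isProjectiveCover {proj : S.Arc → S.PermissibleCurve}
    (hproj : ∀ γ, (proj γ).IsProjective γ) :
    IsProjectiveCover (S.Alg k)ᵐᵒᵖ
      (DirectSum c.TopIndex fun i => (proj (c.arc i.1)).Mod k) (c.Mod k) :=
  (isProjectiveCover_pi (D := c.str.diagram) _ (Module.Basis.singleton Unit k) (fun t : c.TopIndex => t.1)
    (fun t => hproj (c.arc t.1)) Subtype.val_injective c.head_ne_of_topIndex c.exists_topIndex
    c.str.diagram_outInjective).of_equiv
    ((directSumEquivPi _).trans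
      (LinearEquiv.piCongrRight fun _ => (LinearEquiv.funUnique Unit (S.Alg k)ᵐᵒᵖ _).symm))

/-- The injective envelope of a string module. -/
theorem isInjectiveEnvelope {inj : S.Arc → S.PermissibleCurve}
    (hinj : ∀ γ, (inj γ).IsInjective γ) :
    IsInjectiveEnvelope (S.Alg k)ᵐᵒᵖ
      (DirectSum c.SocIndex fun i => (inj (c.arc i.1)).Mod k) (c.Mod k) :=
  isInjectiveEnvelope_pi (D := c.str.diagram) _ (Module.Basis.singleton Unit k) (fun t : c.SocIndex => t.1)
    (fun t => hinj (c.arc t.1)) Subtype.val_injective c.tail_ne_of_socIndex c.exists_socIndex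
    c.str.diagram_inInjective
    ((directSumEquivPi _).trans
      (LinearEquiv.piCongrRight fun _ => (LinearEquiv.funUnique Unit (S.Alg k)ᵐᵒᵖ _).symm))

end PermissibleCurve

namespace PermissibleClosedCurve

variable {S : MarkedRibbonSurface} (c : S.PermissibleClosedCurve)

variable {c} in
lemma IsRight.not_isLeft {i : ZMod c.n} (h : c.IsRight i) : ¬ c.IsLeft i := by
  unfold IsRight at h
  unfold IsLeft
  omega

lemma head_ne_of_topIndex (t : c.TopIndex) (y : c.str.diagram.Y) :
    c.str.diagram.head y ≠ t.1 := by
  obtain ⟨t, h1, h2⟩ := t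
  intro e
  by_cases h : c.IsLeft y
  · rw [c.str.head_of_direct (i := y) h] at e
    exact h1.not_isLeft (eq_sub_of_add_eq (G := ZMod c.n) e ▸ h)
  · rw [c.str.head_of_not_direct (i := y) h] at e
    obtain rfl : y = t := e
    exact h h2

lemma exists_topIndex (x : c.str.diagram.X) (hx : ∀ y, c.str.diagram.head y ≠ x) :
    ∃ t : c.TopIndex, t.1 = x := by
  refine ⟨⟨x, (c.triangle _).resolve_left fun h => ?_, ?_⟩, rfl⟩
  · exact hx _ ((c.str.head_of_direct h).trans (sub_add_cancel (G := ZMod c.n) x 1))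
  · by_contra h
    exact hx _ (c.str.head_of_not_direct h)

lemma tail_ne_of_socIndex (t : c.SocIndex) (y : c.str.diagram.Y) :
    c.str.diagram.tail y ≠ t.1 := by
  obtain ⟨t, h1, h2⟩ := t
  intro e
  by_cases h : c.IsLeft y
  · rw [c.str.tail_of_direct (i := y) h] at e
    obtain rfl : y = t := e
    exact h2.not_isLeft h
  · rw [c.str.tail_of_not_direct (i := y) h] at e
    exact h (eq_sub_of_add_eq (G := ZMod c.n) e ▸ h1)

lemma exists_socIndex (x : c.str.diagram.X) (hx : ∀ y, c.str.diagram.tail y ≠ x) :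
    ∃ t : c.SocIndex, t.1 = x := by
  refine ⟨⟨x, ?_, (c.triangle _).resolve_left fun h => ?_⟩, rfl⟩
  · by_contra h
    exact hx _ ((c.str.tail_of_not_direct h).trans (sub_add_cancel (G := ZMod c.n) x 1))
  · exact hx _ (c.str.tail_of_direct h)

instance : Finite c.TopIndex := inferInstanceAs (Finite {_i : ZMod c.n // _})

instance : Finite c.SocIndex := inferInstanceAs (Finite {_i : ZMod c.n // _})

variable {k : Type*} [Field k] {V : Type*} [AddCommGroup V] [Module k V] [FiniteDimensional k V]
  (φ : V ≃ₗ[k] V)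

/-- The projective cover of a band module. -/
theorem isProjectiveCover {proj : S.Arc → S.PermissibleCurve}
    (hproj : ∀ γ, (proj γ).IsProjective γ) :
    IsProjectiveCover (S.Alg k)ᵐᵒᵖ
      (DirectSum c.TopIndex fun i => Fin (Module.finrank k V) → (proj (c.arc i.1)).Mod k)
      (c.Mod k V φ) :=
  (isProjectiveCover_pi (D := c.str.diagram) _ (Module.finBasis k V) (fun t : c.TopIndex => t.1)
    (fun t => hproj (c.arc t.1)) Subtype.val_injective c.head_ne_of_topIndex c.exists_topIndex
    c.str.diagram_outInjective).of_equiv (directSumEquivPi _)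

/-- The injective envelope of a band module. -/
theorem isInjectiveEnvelope {inj : S.Arc → S.PermissibleCurve}
    (hinj : ∀ γ, (inj γ).IsInjective γ) :
    IsInjectiveEnvelope (S.Alg k)ᵐᵒᵖ
      (DirectSum c.SocIndex fun i => Fin (Module.finrank k V) → (inj (c.arc i.1)).Mod k)
      (c.Mod k V φ) :=
  isInjectiveEnvelope_pi (D := c.str.diagram) _ (Module.finBasis k V) (fun t : c.SocIndex => t.1)
    (fun t => hinj (c.arc t.1)) Subtype.val_injective c.tail_ne_of_socIndex c.exists_socIndex
    c.str.diagram_inInjective (directSumEquivPi _)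

end PermissibleClosedCurve

end MarkedRibbonSurface

/-! ### Construction of permissible curves -/

/-- The pieces are continuous on all of `ℝ`, so attaching the next one only requires agreement at
the breakpoint. -/
lemma exists_continuous_of_pieces {X : Type*} [TopologicalSpace X] {time : ℕ → ℝ}
    (ht : Monotone time) {f : ℕ → ℝ → X} (m : ℕ) (hf : ∀ i ≤ m, Continuous (f i))
    (hj : ∀ i < m, f i (time (i + 1)) = f (i + 1) (time (i + 1))) :
    ∃ F : ℝ → X, Continuous F ∧ ∀ i ≤ m, ∀ t ∈ Set.Icc (time i) (time (i + 1)), F t = f i t := by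
  classical
  induction m with
  | zero =>
    refine ⟨f 0, hf 0 le_rfl, fun i hi t _ => ?_⟩
    rw [Nat.le_zero.1 hi]
  | succ m ih =>
    obtain ⟨F, hF, h⟩ := ih (fun i hi => hf i (by omega)) (fun i hi => hj i (by omega))
    have e : F (time (m + 1)) = f (m + 1) (time (m + 1)) := by
      rw [h m le_rfl _ (Set.right_mem_Icc.2 (ht (Nat.le_succ m))), hj m (Nat.lt_succ_self m)]
    refine ⟨fun t => if t ≤ time (m + 1) then F t else f (m + 1) t,
      Continuous.if_le hF (hf _ le_rfl) continuous_id continuous_const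
        (by rintro t rfl; exact e), fun i hi t hti => ?_⟩
    simp only
    rcases Nat.lt_or_ge m i with him | him
    · obtain rfl : i = m + 1 := by omega
      split_ifs with h'
      · rw [le_antisymm h' hti.1, e]
      · rfl
    · rw [if_pos (hti.2.trans (ht (by omega)))]
      exact h i him t hti

/-! ### Points on sides, and paths inside a polygon -/

namespace MarkedRibbonSurface

open PolygonGluing Set

section Points

variable {S : MarkedRibbonSurface}

lemma side_mem_cell (h : S.Side) {x : ℝ} (hx : x ∈ Icc (0 : ℝ) 1) :
    ((h.2.val : ℝ) + x, (1 : ℝ)) ∈ S.cell h.1 := by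
  have h1 : ((h.2.val + 1 : ℕ) : ℝ) ≤ S.size h.1 := by exact_mod_cast ZMod.val_lt h.2
  have h2 : (0 : ℝ) ≤ h.2.val := Nat.cast_nonneg _
  obtain ⟨hx0, hx1⟩ := hx
  push_cast at h1
  exact ⟨zero_le_one, le_rfl, Or.inr ⟨by simp only; linarith, by simp only; linarith⟩⟩

/-- The point with coordinate `x` on a side. -/
def sidePoint (h : S.Side) (x : Icc (0 : ℝ) 1) : S.Surface :=
  Quot.mk _ ⟨h.1, _, side_mem_cell h x.2⟩

lemma isPoint_sidePoint (h : S.Side) (x : Icc (0 : ℝ) 1) :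
    S.IsPoint h.1 ((h.2.val : ℝ) + x, 1) (sidePoint h x) := ⟨_, rfl⟩

lemma IsPoint.unique {j : S.Polygon} {p : ℝ × ℝ} {s t : S.Surface} (hs : S.IsPoint j p s)
    (ht : S.IsPoint j p t) : s = t := by
  obtain ⟨_, rfl⟩ := hs
  obtain ⟨_, rfl⟩ := ht
  rfl

lemma sidePoint_flip (h : S.Side) (x : Icc (0 : ℝ) 1) :
    sidePoint (flip h) (unitInterval.symm x) = sidePoint h x :=
  (Quot.sound (Glued.side h x _ _ x.2 rfl rfl)).symm

/-- Lets neighbouring sides be placed at consecutive integers even when the index wraps around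
modulo the size. That happens only in an unmarked polygon, where the strip continues and
`Glued.wrap` identifies the points. -/
lemma isPoint_next (h : S.Side) (hn : HasNext h) (x : Icc (0 : ℝ) 1) :
    S.IsPoint h.1 ((h.2.val : ℝ) + 1 + x, 1) (sidePoint (next h) x) := by
  have hlt := ZMod.val_lt h.2
  have hnext : (next h).2 = ((h.2.val + 1 : ℕ) : ZMod (S.size h.1)) := by
    rw [Nat.cast_add, Nat.cast_one, ZMod.natCast_zmod_val]
    rfl
  rcases Nat.lt_or_ge (h.2.val + 1) (S.size h.1) with hl | hl
  · have e : ((next h).2.val : ℝ) = h.2.val + 1 := by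
      have : (next h).2.val = h.2.val + 1 := by
        rw [hnext]
        exact ZMod.val_natCast_of_lt hl
      rw [this, Nat.cast_add, Nat.cast_one]
    rw [← e]
    exact isPoint_sidePoint (next h) x
  · have hs : h.2.val + 1 = S.size h.1 := by omega
    have h0 : (next h).2 = 0 := by
      rw [hnext, hs]
      exact ZMod.natCast_self _
    have hu : S.unmarked h.1 := by
      refine hn.resolve_right fun hne => hne ?_
      rw [eq_neg_iff_add_eq_zero]
      exact h0
    have hv : (next h).2.val = 0 := by
      rw [h0]
      exact ZMod.val_zero
    refine ⟨⟨zero_le_one, le_rfl, Or.inl hu⟩, Quot.sound (Glued.wrap h.1 _ _ hu ?_)⟩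
    have hs' : (h.2.val : ℝ) + 1 = S.size h.1 := by exact_mod_cast hs
    change ((h.2.val : ℝ) + 1 + x, (1 : ℝ)) = (((next h).2.val : ℝ) + x + S.size h.1, 1)
    rw [hs', hv, Nat.cast_zero, zero_add, add_comm]

lemma sidePoint_next (h : S.Side) (hn : HasNext h) : sidePoint (next h) 0 = sidePoint h 1 := by
  refine (isPoint_next h hn 0).unique ?_
  have := isPoint_sidePoint h 1
  simpa using this

/-- A path from `p` to `q` in the strip `ℝ × [0, 1]`, bent downwards. -/
noncomputable def bentPath (p q : ℝ × ℝ) (s : ℝ) : ℝ × ℝ :=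
  -- The quadratic dip takes the path off the line `ℝ × {1}` when both ends lie on it; the factor
  -- one half keeps it above `ℝ × {0}` as soon as one end has height `1`.
  ((1 - s) * p.1 + s * q.1, (1 - s) * p.2 + s * q.2 - s * (1 - s) / 2)

lemma continuous_bentPath (p q : ℝ × ℝ) : Continuous (bentPath p q) := by
  unfold bentPath
  fun_prop

lemma bentPath_zero (p q : ℝ × ℝ) : bentPath p q 0 = p := by
  simp [bentPath]

lemma bentPath_one (p q : ℝ × ℝ) : bentPath p q 1 = q := by
  simp [bentPath]

/-- Two points of a polygon joined by a bent path whose interior is in the open polygon. -/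
structure Joinable (j : S.Polygon) (p q : ℝ × ℝ) : Prop where
  left_mem : p ∈ S.cell j
  right_mem : q ∈ S.cell j
  top : p.2 = 1 ∨ q.2 = 1
  inner : S.unmarked j ∨ (0 < p.1 ∧ p.1 < S.size j) ∨ (0 < q.1 ∧ q.1 < S.size j)

lemma Joinable.mem_cell {j : S.Polygon} {p q : ℝ × ℝ} (h : Joinable j p q) {s : ℝ}
    (hs : s ∈ Icc (0 : ℝ) 1) : bentPath p q s ∈ S.cell j := by
  obtain ⟨⟨hp0, hp1, hp⟩, ⟨hq0, hq1, hq⟩, ht, -⟩ := h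
  obtain ⟨hs0, hs1⟩ := hs
  have a1 := mul_nonneg (sub_nonneg.2 hs1) hp0
  have a2 := mul_nonneg hs0 hq0
  have a3 := mul_nonneg hs0 (sub_nonneg.2 hs1)
  have a4 := mul_nonneg (sub_nonneg.2 hs1) (sub_nonneg.2 hp1)
  have a5 := mul_nonneg hs0 (sub_nonneg.2 hq1)
  have a6 := mul_nonneg (sub_nonneg.2 hs1) (sub_nonneg.2 hs1)
  refine ⟨?_, ?_, ?_⟩
  · rcases ht with ht | ht <;> simp only [bentPath, ht] at * <;> nlinarith
  · simp only [bentPath]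
    nlinarith
  · by_cases hu : S.unmarked j
    · exact Or.inl hu
    · obtain ⟨hp2, hp3⟩ := hp.resolve_left hu
      obtain ⟨hq2, hq3⟩ := hq.resolve_left hu
      have b1 := mul_nonneg (sub_nonneg.2 hs1) hp2
      have b2 := mul_nonneg hs0 hq2
      have b3 := mul_nonneg (sub_nonneg.2 hs1) (sub_nonneg.2 hp3)
      have b4 := mul_nonneg hs0 (sub_nonneg.2 hq3)
      refine Or.inr ⟨?_, ?_⟩ <;> simp only [bentPath] <;> nlinarith

lemma Joinable.mem_openCell {j : S.Polygon} {p q : ℝ × ℝ} (h : Joinable j p q) {s : ℝ}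
    (hs : s ∈ Ioo (0 : ℝ) 1) : bentPath p q s ∈ S.openCell j := by
  obtain ⟨⟨hp0, hp1, hp⟩, ⟨hq0, hq1, hq⟩, ht, hi⟩ := h
  obtain ⟨hs0, hs1⟩ := hs
  have a1 := mul_nonneg (sub_pos.2 hs1).le hp0
  have a2 := mul_nonneg hs0.le hq0
  have a3 := mul_pos hs0 (sub_pos.2 hs1)
  have a4 := mul_nonneg (sub_pos.2 hs1).le (sub_nonneg.2 hp1)
  have a5 := mul_nonneg hs0.le (sub_nonneg.2 hq1)
  have a6 := mul_pos (sub_pos.2 hs1) (sub_pos.2 hs1)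
  refine ⟨?_, ?_, ?_⟩
  -- With one end at height `1` the linear part is at least `1 - s` or `s`, and each of these
  -- exceeds the dip `s * (1 - s) / 2`.
  · rcases ht with ht | ht <;> simp only [bentPath, ht] at * <;> nlinarith
  · simp only [bentPath]
    nlinarith
  · by_cases hu : S.unmarked j
    · exact Or.inl hu
    · obtain ⟨hp2, hp3⟩ := hp.resolve_left hu
      obtain ⟨hq2, hq3⟩ := hq.resolve_left hu
      have b1 := mul_nonneg (sub_pos.2 hs1).le hp2
      have b2 := mul_nonneg hs0.le hq2
      have b3 := mul_nonneg (sub_pos.2 hs1).le (sub_nonneg.2 hp3)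
      have b4 := mul_nonneg hs0.le (sub_nonneg.2 hq3)
      right
      rcases hi.resolve_left hu with ⟨h1, h2⟩ | ⟨h1, h2⟩
      · have c1 := mul_pos (sub_pos.2 hs1) h1
        have c2 := mul_pos (sub_pos.2 hs1) (sub_pos.2 h2)
        refine ⟨?_, ?_⟩ <;> simp only [bentPath] <;> nlinarith
      · have c1 := mul_pos hs0 h1
        have c2 := mul_pos hs0 (sub_pos.2 h2)
        refine ⟨?_, ?_⟩ <;> simp only [bentPath] <;> nlinarith

lemma Joinable.exists_map {j : S.Polygon} {p q : ℝ × ℝ} (h : Joinable j p q) :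
    ∃ g : ℝ → S.Surface, Continuous g ∧ ∀ s ∈ Icc (0 : ℝ) 1, S.IsPoint j (bentPath p q s) (g s) := by
  let g : Icc (0 : ℝ) 1 → S.Surface := fun s => Quot.mk _ ⟨j, _, h.mem_cell s.2⟩
  have hg : Continuous g := by
    refine continuous_quot_mk.comp (continuous_sigmaMk.comp ?_)
    exact Continuous.subtype_mk ((continuous_bentPath p q).comp continuous_subtype_val) _
  refine ⟨Set.IccExtend zero_le_one g, hg.Icc_extend', fun s hs => ?_⟩
  rw [Set.IccExtend_of_mem _ _ hs]
  exact ⟨_, rfl⟩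

/-- A sequence of bent paths which fit together is a permissible curve. -/
lemma exists_permissibleCurve_of_joinable (n : ℕ) (poly : ℕ → S.Polygon) (entry exit : ℕ → ℤ)
    (A B : ℕ → ℝ × ℝ) (hAB : ∀ i ≤ n + 1, Joinable (poly i) (A i) (B i))
    (hB : ∀ i ≤ n, OnSide (exit i) (B i)) (hA : ∀ i ≤ n, OnSide (entry (i + 1)) (A (i + 1)))
    (hglue : ∀ i ≤ n, ∃ s, S.IsPoint (poly i) (B i) s ∧ S.IsPoint (poly (i + 1)) (A (i + 1)) s)
    (cross : ∀ i ≤ n, sideAt (poly (i + 1)) (entry (i + 1)) = flip (sideAt (poly i) (exit i)))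
    (triangle : ∀ i, 1 ≤ i → i ≤ n → exit i = entry i + 1 ∨ exit i = entry i - 1)
    (start : IsEndpoint (poly 0) (exit 0) (A 0))
    (finish : IsEndpoint (poly (n + 1)) (entry (n + 1)) (B (n + 1))) :
    ∃ c : S.PermissibleCurve, c.n = n ∧ c.poly = poly ∧ c.entry = entry ∧ c.exit = exit := by
  -- There are `n + 2` segments, two of them end segments; each gets the same share of `[0, 1]`, and
  -- `N * t - i` is the parameter on the segment `i`.
  let N : ℝ := n + 2
  have hN : 0 < N := by positivity
  let time : ℕ → ℝ := fun i => i / N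
  have htime : ∀ i, N * time i = i := fun i => mul_div_cancel₀ _ hN.ne'
  have hlt : ∀ i, time i < time (i + 1) := fun i =>
    div_lt_div_of_pos_right (by exact_mod_cast Nat.lt_succ_self i) hN
  have hmono : Monotone time := monotone_nat_of_le_succ fun i => (hlt i).le
  -- Supplies the default value that `choose!` needs for indices beyond `n + 1`.
  have : Nonempty S.Surface := (hglue 0 (Nat.zero_le _)).nonempty
  choose! g hg hgp using fun i hi => (hAB i hi).exists_map
  let coord : ℕ → ℝ → ℝ × ℝ := fun i t => bentPath (A i) (B i) (N * t - i)
  have hparam : ∀ i t, t ∈ Icc (time i) (time (i + 1)) → N * t - i ∈ Icc (0 : ℝ) 1 := by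
    intro i t ht
    have h1 := mul_le_mul_of_nonneg_left ht.1 hN.le
    have h2 := mul_le_mul_of_nonneg_left ht.2 hN.le
    rw [htime] at h1 h2
    push_cast at h2
    exact ⟨by linarith, by linarith⟩
  have hend : ∀ i, coord i (time (i + 1)) = B i := by
    intro i
    simp only [coord, htime]
    rw [Nat.cast_add, Nat.cast_one, add_sub_cancel_left, bentPath_one]
  have hbeg : ∀ i, coord i (time i) = A i := by
    intro i
    simp only [coord, htime]
    rw [sub_self, bentPath_zero]
  obtain ⟨F, hF, hFg⟩ := exists_continuous_of_pieces hmono (f := fun i t => g i (N * t - i)) (n + 1)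
    (fun i hi => (hg i hi).comp (by fun_prop)) (by
      intro i hi
      obtain ⟨s, h1, h2⟩ := hglue i (by omega)
      have e1 := hgp i (by omega) _ (hparam i _ (right_mem_Icc.2 (hlt i).le))
      have e2 := hgp (i + 1) (by omega) _ (hparam (i + 1) _ (left_mem_Icc.2 (hlt (i + 1)).le))
      have h1' := hend i
      have h2' := hbeg (i + 1)
      simp only [coord] at h1' h2'
      rw [h1'] at e1
      rw [h2'] at e2
      exact (e1.unique h1).trans (h2.unique e2))
  have hsub : ∀ i, time i = (i : ℝ) / N := fun _ => rfl
  refine ⟨{ toFun := F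
            continuousOn := hF.continuousOn
            n := n
            time := time
            time_zero := by rw [hsub, Nat.cast_zero, zero_div]
            time_last := by
              rw [hsub, Nat.cast_add]
              exact div_self hN.ne'
            time_lt := fun i _ => hlt i
            poly := poly
            coord := coord
            entry := entry
            exit := exit
            segment := fun i hi =>
              { continuousOn :=
                  ((continuous_bentPath (A i) (B i)).comp (by fun_prop)).continuousOn
                isPoint := fun t ht => by
                  rw [hFg i hi t ht]
                  exact hgp i hi _ (hparam i t ht)
                interior := fun t ht => by
                  refine (hAB i hi).mem_openCell ?_
                  have h1 := mul_lt_mul_of_pos_left ht.1 hN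
                  have h2 := mul_lt_mul_of_pos_left ht.2 hN
                  rw [htime] at h1 h2
                  push_cast at h2
                  exact ⟨by linarith, by linarith⟩ }
            exit_mem := fun i hi => by
              rw [hend]
              exact hB i hi
            entry_mem := fun i hi => by
              rw [hbeg]
              exact hA i hi
            cross := cross
            triangle := triangle
            start := by
              have := hbeg 0
              rw [hsub, Nat.cast_zero, zero_div] at this
              rw [this]
              exact start
            finish := by
              have := hend (n + 1)
              have e : time (n + 1 + 1) = 1 := by
                rw [hsub, Nat.cast_add, Nat.cast_add, Nat.cast_one, add_assoc, one_add_one_eq_two]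
                exact div_self hN.ne'
              rw [e] at this
              rw [this]
              exact finish }, rfl, rfl, rfl, rfl⟩

end Points

end MarkedRibbonSurface

/-! ### From sequences of sides to permissible curves -/

namespace MarkedRibbonSurface

open PolygonGluing Set

section SideSequences

variable {S : MarkedRibbonSurface}

lemma sideAt_val (h : S.Side) : sideAt h.1 (h.2.val : ℤ) = h := by
  have : ((h.2.val : ℤ) : ZMod (S.size h.1)) = h.2 := by
    rw [Int.cast_natCast, ZMod.natCast_zmod_val]
  exact congrArg (Sigma.mk h.1) this

/-- The midpoint of the side `l` of a polygon. -/
noncomputable def midpoint (l : ℤ) : ℝ × ℝ := ((l : ℝ) + 1 / 2, 1)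

lemma onSide_midpoint (l : ℤ) : OnSide l (midpoint l) :=
  ⟨rfl, by simp only [midpoint]; linarith, by simp only [midpoint]; linarith⟩

/-- The side `l` of the polygon `j` lies over the edge of its model. -/
def IsSideIndex (j : S.Polygon) (l : ℤ) : Prop := S.unmarked j ∨ (0 ≤ l ∧ l + 1 ≤ S.size j)

lemma isSideIndex_val (h : S.Side) : IsSideIndex h.1 (h.2.val : ℤ) :=
  Or.inr ⟨Int.natCast_nonneg _, by exact_mod_cast ZMod.val_lt h.2⟩

lemma isSideIndex_val_add_one {h : S.Side} (hn : HasNext h) :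
    IsSideIndex h.1 (h.2.val + 1 : ℤ) := by
  rcases hn with hu | hne
  · exact Or.inl hu
  · refine Or.inr ⟨by positivity, ?_⟩
    have hlt := ZMod.val_lt h.2
    have : h.2.val + 1 ≠ S.size h.1 := by
      intro e
      apply hne
      rw [eq_neg_iff_add_eq_zero]
      have e' := congrArg (Nat.cast : ℕ → ZMod (S.size h.1)) e
      rwa [Nat.cast_add, Nat.cast_one, ZMod.natCast_zmod_val, ZMod.natCast_self] at e'
    exact_mod_cast (show h.2.val + 1 + 1 ≤ S.size h.1 by omega)

lemma IsSideIndex.inner {j : S.Polygon} {l : ℤ} (h : IsSideIndex j l) :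
    S.unmarked j ∨ (0 < (midpoint l).1 ∧ (midpoint l).1 < S.size j) := by
  refine h.imp_right fun ⟨h1, h2⟩ => ?_
  have h1' : (0 : ℝ) ≤ l := by exact_mod_cast h1
  have h2' : (l : ℝ) + 1 ≤ S.size j := by exact_mod_cast h2
  constructor <;> simp only [midpoint] <;> linarith

lemma IsSideIndex.midpoint_mem {j : S.Polygon} {l : ℤ} (h : IsSideIndex j l) :
    midpoint l ∈ S.cell j :=
  ⟨zero_le_one, le_rfl, h.inner.imp_right fun h => ⟨h.1.le, h.2.le⟩⟩

lemma IsSideIndex.joinable {j : S.Polygon} {l l' : ℤ} (h : IsSideIndex j l)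
    (h' : IsSideIndex j l') : Joinable j (midpoint l) (midpoint l') :=
  ⟨h.midpoint_mem, h'.midpoint_mem, Or.inl rfl, h.inner.imp_right Or.inl⟩

/-- Every side can be joined to an admissible endpoint. -/
lemma exists_isEndpoint (h : S.Side) :
    ∃ p, p ∈ S.cell h.1 ∧ IsEndpoint h.1 (h.2.val : ℤ) p := by
  have hpos : 0 < S.size h.1 := Nat.pos_of_ne_zero (NeZero.ne _)
  have hlt := ZMod.val_lt h.2
  by_cases hu : S.unmarked h.1
  -- In the strip, the first corner beyond the side and its endpoints; it meets the winding bound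
  -- because the size is at least `1`.
  · refine ⟨((((h.2.val : ℤ) + 2 : ℤ) : ℝ), 1), ⟨zero_le_one, le_rfl, Or.inl hu⟩,
      Or.inl ⟨_, rfl, ?_⟩⟩
    omega
  · by_cases h1 : S.size h.1 = 1
    · refine ⟨(1 / 2, 0), ⟨le_rfl, zero_le_one, Or.inr ?_⟩, Or.inr ⟨hu, h1, rfl⟩⟩
      rw [h1]
      norm_num
    -- A polygon with at least two arc sides has a corner off the given side: the last corner if the
    -- side is the first one, and the corner `0` otherwise.
    · by_cases h0 : h.2.val = 0
      · refine ⟨(((S.size h.1 : ℤ) : ℝ), 1), ⟨zero_le_one, le_rfl, Or.inr ?_⟩,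
          Or.inl ⟨_, rfl, ?_⟩⟩
        · simp
        · omega
      · refine ⟨(((0 : ℤ) : ℝ), 1), ⟨zero_le_one, le_rfl, Or.inr ?_⟩, Or.inl ⟨_, rfl, ?_⟩⟩
        · simp
        · omega

lemma isPoint_midpoint (h : S.Side) :
    S.IsPoint h.1 (midpoint (h.2.val : ℤ)) (sidePoint h ⟨1 / 2, by norm_num, by norm_num⟩) := by
  have := isPoint_sidePoint h ⟨1 / 2, by norm_num, by norm_num⟩
  simpa [midpoint] using this

lemma isPoint_midpoint_add_one (h : S.Side) (hn : HasNext h) :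
    S.IsPoint h.1 (midpoint (h.2.val + 1 : ℤ))
      (sidePoint (next h) ⟨1 / 2, by norm_num, by norm_num⟩) := by
  have := isPoint_next h hn ⟨1 / 2, by norm_num, by norm_num⟩
  simpa [midpoint] using this

lemma sidePoint_flip_half (h : S.Side) :
    sidePoint (flip h) ⟨1 / 2, by norm_num, by norm_num⟩ =
      sidePoint h ⟨1 / 2, by norm_num, by norm_num⟩ := by
  rw [← sidePoint_flip h]
  congr 1
  ext
  simp [unitInterval.symm]
  norm_num

/-- A sequence of sides `G 0, …, G n`, in which `flip (G i)` and `G (i + 1)` are neighbours, is the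
sequence of sides through which a permissible curve leaves its polygons; it turns left at `i` if
`left i`, and right otherwise. -/
lemma exists_permissibleCurve (n : ℕ) (G : ℕ → S.Side) (left : ℕ → Prop)
    (hleft : ∀ i < n, left (i + 1) → HasNext (flip (G i)) ∧ G (i + 1) = next (flip (G i)))
    (hright : ∀ i < n, ¬ left (i + 1) → HasNext (G (i + 1)) ∧ flip (G i) = next (G (i + 1))) :
    ∃ c : S.PermissibleCurve, c.n = n ∧ (∀ i ≤ n, sideAt (c.poly i) (c.exit i) = G i) ∧
      (∀ i < n, left (i + 1) → c.IsLeft (i + 1) ∧ c.IsPivot (i + 1) (sidePoint (G (i + 1)) 0)) ∧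
      (∀ i < n, ¬ left (i + 1) →
        c.IsRight (i + 1) ∧ c.IsPivot (i + 1) (sidePoint (G (i + 1)) 1)) := by
  classical
  -- `left` is extended to the end segments: `0` counts as a right turn and `n + 1` as a left turn,
  -- so that `base` is there the only side crossed. In a middle segment `base` is the earlier of the
  -- two neighbouring sides, and the other has coordinate one more.
  let L : ℕ → Prop := fun i => i ≠ 0 ∧ (i ≤ n → left i)
  let base : ℕ → S.Side := fun i => if L i then flip (G (i - 1)) else G i
  let entry : ℕ → ℤ := fun i => if L i then (base i).2.val else (base i).2.val + 1
  let exit : ℕ → ℤ := fun i => if L i then (base i).2.val + 1 else (base i).2.val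
  have hL0 : ¬ L 0 := fun h => h.1 rfl
  have hLn : L (n + 1) := ⟨Nat.succ_ne_zero n, fun h => absurd h (by omega)⟩
  have hLi : ∀ i < n, (L (i + 1) ↔ left (i + 1)) := fun i hi =>
    ⟨fun h => h.2 hi, fun h => ⟨Nat.succ_ne_zero i, fun _ => h⟩⟩
  have baseL : ∀ i, L (i + 1) → base (i + 1) = flip (G i) := fun i h => if_pos h
  have baseR : ∀ i, ¬ L i → base i = G i := fun i h => if_neg h
  have entryL : ∀ i, L i → entry i = (base i).2.val := fun i h => if_pos h
  have entryR : ∀ i, ¬ L i → entry i = (base i).2.val + 1 := fun i h => if_neg h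
  have exitL : ∀ i, L i → exit i = (base i).2.val + 1 := fun i h => if_pos h
  have exitR : ∀ i, ¬ L i → exit i = (base i).2.val := fun i h => if_neg h
  have hbase : ∀ i < n, HasNext (base (i + 1)) := by
    intro i hi
    by_cases h : L (i + 1)
    · rw [baseL i h]
      exact (hleft i hi ((hLi i hi).1 h)).1
    · rw [baseR _ h]
      exact (hright i hi fun h' => h ((hLi i hi).2 h')).1
  have hexit : ∀ i ≤ n, sideAt (base i).1 (exit i) = G i := by
    intro i hi
    by_cases h : L i
    · obtain ⟨i, rfl⟩ := Nat.exists_eq_succ_of_ne_zero h.1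
      rw [exitL _ h, sideAt_add_one, sideAt_val, baseL i h]
      exact (hleft i hi ((hLi i hi).1 h)).2.symm
    · rw [exitR _ h, sideAt_val, baseR _ h]
  have hentry : ∀ i ≤ n, sideAt (base (i + 1)).1 (entry (i + 1)) = flip (G i) := by
    intro i hi
    by_cases h : L (i + 1)
    · rw [entryL _ h, sideAt_val, baseL i h]
    · have hi' : i < n := lt_of_le_of_ne hi fun e => h (e ▸ hLn)
      rw [entryR _ h, sideAt_add_one, sideAt_val, baseR _ h]
      exact (hright i hi' fun h' => h ((hLi i hi').2 h')).2.symm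
  have hexitP : ∀ i ≤ n, S.IsPoint (base i).1 (midpoint (exit i))
      (sidePoint (G i) ⟨1 / 2, by norm_num, by norm_num⟩) := by
    intro i hi
    by_cases h : L i
    · obtain ⟨i, rfl⟩ := Nat.exists_eq_succ_of_ne_zero h.1
      rw [exitL _ h, (hleft i hi ((hLi i hi).1 h)).2, ← baseL i h]
      exact isPoint_midpoint_add_one _ (hbase i hi)
    · rw [exitR _ h, ← baseR _ h]
      exact isPoint_midpoint _
  have hentryP : ∀ i ≤ n, S.IsPoint (base (i + 1)).1 (midpoint (entry (i + 1)))
      (sidePoint (flip (G i)) ⟨1 / 2, by norm_num, by norm_num⟩) := by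
    intro i hi
    by_cases h : L (i + 1)
    · rw [entryL _ h, ← baseL i h]
      exact isPoint_midpoint _
    · have hi' : i < n := lt_of_le_of_ne hi fun e => h (e ▸ hLn)
      rw [entryR _ h, (hright i hi' fun h' => h ((hLi i hi').2 h')).2, ← baseR _ h]
      exact isPoint_midpoint_add_one _ (hbase i hi')
  have hindex : ∀ i < n, IsSideIndex (base (i + 1)).1 (entry (i + 1)) ∧
      IsSideIndex (base (i + 1)).1 (exit (i + 1)) := by
    intro i hi
    by_cases h : L (i + 1)
    · rw [entryL _ h, exitL _ h]
      exact ⟨isSideIndex_val _, isSideIndex_val_add_one (hbase i hi)⟩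
    · rw [entryR _ h, exitR _ h]
      exact ⟨isSideIndex_val_add_one (hbase i hi), isSideIndex_val _⟩
  obtain ⟨a, ha, hae⟩ := exists_isEndpoint (base 0)
  obtain ⟨b, hb, hbe⟩ := exists_isEndpoint (base (n + 1))
  rw [← exitR 0 hL0] at hae
  rw [← entryL _ hLn] at hbe
  have hi0 : IsSideIndex (base 0).1 (exit 0) := by
    rw [exitR 0 hL0]
    exact isSideIndex_val _
  have hin : IsSideIndex (base (n + 1)).1 (entry (n + 1)) := by
    rw [entryL _ hLn]
    exact isSideIndex_val _
  obtain ⟨c, rfl, hp, he, hx⟩ := exists_permissibleCurve_of_joinable n (fun i => (base i).1) entry exit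
    (fun i => if i = 0 then a else midpoint (entry i))
    (fun i => if i = n + 1 then b else midpoint (exit i)) (by
      intro i hi
      rcases i with _ | i
      · rw [if_pos rfl, if_neg (by omega)]
        exact ⟨ha, hi0.midpoint_mem, Or.inr rfl, hi0.inner.imp_right Or.inr⟩
      · rw [if_neg (Nat.succ_ne_zero i)]
        split_ifs with h
        · obtain rfl : i = n := by omega
          exact ⟨hin.midpoint_mem, hb, Or.inl rfl, hin.inner.imp_right Or.inl⟩
        · exact (hindex i (by omega)).1.joinable (hindex i (by omega)).2)
    (fun i hi => by
      simp only [if_neg (show i ≠ n + 1 by omega)]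
      exact onSide_midpoint _)
    (fun i hi => by
      simp only [if_neg (Nat.succ_ne_zero i)]
      exact onSide_midpoint _)
    (fun i hi => by
      simp only [if_neg (show i ≠ n + 1 by omega), if_neg (Nat.succ_ne_zero i)]
      refine ⟨_, hexitP i hi, ?_⟩
      rw [← sidePoint_flip_half]
      exact hentryP i hi)
    (fun i hi => by rw [hexit i hi, hentry i hi])
    (fun i _ _ => by
      by_cases h : L i
      · exact Or.inl (by rw [exitL i h, entryL i h])
      · exact Or.inr (by rw [exitR i h, entryR i h]; ring))
    (by
      simp only
      exact hae)
    (by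
      simp only
      exact hbe)
  refine ⟨c, rfl, fun i hi => ?_, fun i hi h => ?_, fun i hi h => ?_⟩
  · rw [hp, hx]
    exact hexit i hi
  · have h' := (hLi i hi).2 h
    have e1 := exitL _ h'
    have e2 := entryL _ h'
    constructor
    · rw [PermissibleCurve.IsLeft, hx, he, e1, e2]
    · rw [PermissibleCurve.IsPivot, hx, he, hp, max_eq_right (by omega), e1,
        (hleft i hi h).2, ← baseL i h']
      have := isPoint_next _ (hbase i hi) 0
      simpa using this
  · have h' : ¬ L (i + 1) := fun h' => h ((hLi i hi).1 h')
    have e1 := exitR _ h'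
    have e2 := entryR _ h'
    constructor
    · rw [PermissibleCurve.IsRight, hx, he, e1, e2]
      ring
    · rw [PermissibleCurve.IsPivot, hx, he, hp, max_eq_left (by omega), e2, ← baseR _ h']
      have := isPoint_sidePoint (base (i + 1)) 1
      simpa using this

end SideSequences

end MarkedRibbonSurface

/-! ### Existence of projective and injective permissible curves -/

namespace MarkedRibbonSurface

open PolygonGluing Set

section Existence

variable {S : MarkedRibbonSurface}

/-- The preceding side of the same polygon. -/
def prev (h : S.Side) : S.Side := ⟨h.1, h.2 - 1⟩

lemma next_prev (h : S.Side) : next (prev h) = h :=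
  congrArg (Sigma.mk h.1) (sub_add_cancel h.2 1)

lemma hasNext_prev_iff (h : S.Side) : HasNext (prev h) ↔ HasPrev h := by
  rw [← hasPrev_next_iff, next_prev]

/-- On turning clockwise about an endpoint of an arc, one ends at a boundary segment. -/
lemma exists_not_hasPrev (h : S.Side) : ∃ m, ¬ HasPrev ((fun x => flip (prev x))^[m] h) := by
  obtain ⟨B, hB⟩ := (Set.finite_range (rank : S.Side → ℕ)).bddAbove
  -- Turning clockwise undoes a counterclockwise turn, so it raises `rank (flip h)` by one.
  -- Finiteness of the set of sides bounds the rank and forces the turning to stop.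
  have key : ∀ d (h : S.Side), B ≤ rank (flip h) + d →
      ∃ m, ¬ HasPrev ((fun x => flip (prev x))^[m] h) := by
    intro d
    induction d with
    | zero =>
      intro h hd
      refine ⟨0, fun hp => ?_⟩
      have h1 := rank_eq_succ ((hasNext_prev_iff h).2 hp)
      have h2 := hB ⟨prev h, rfl⟩
      rw [next_prev] at h1
      omega
    | succ d ih =>
      intro h hd
      by_cases hp : HasPrev h
      · have h1 := rank_eq_succ ((hasNext_prev_iff h).2 hp)
        rw [next_prev, ← flip_flip_side (prev h)] at h1
        obtain ⟨m, hm⟩ := ih (flip (prev h)) (by omega)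
        exact ⟨m + 1, by rwa [Function.iterate_succ_apply]⟩
      · exact ⟨0, hp⟩
  exact key B h (by omega)

/-- Two sequences of sides `τ^i (flip h)` and `τ^i h`, the first one reversed, joined at the arc of
`h`: the sides through which a curve turning about both endpoints of this arc leaves its polygons. -/
def sideSeq (τ : S.Side → S.Side) (h : S.Side) (a i : ℕ) : S.Side :=
  if i ≤ a then τ^[a - i] (flip h) else flip (τ^[i - a] h)

lemma sideSeq_of_le {τ : S.Side → S.Side} {h : S.Side} {a i : ℕ} (hi : i ≤ a) :
    sideSeq τ h a i = τ^[a - i] (flip h) := if_pos hi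

lemma sideSeq_of_ge {τ : S.Side → S.Side} {h : S.Side} {a i : ℕ} (hi : a ≤ i) :
    sideSeq τ h a i = flip (τ^[i - a] h) := by
  rcases hi.eq_or_lt with rfl | hi
  · rw [sideSeq_of_le le_rfl, Nat.sub_self]
    rfl
  · exact if_neg (by omega)

lemma sideSeq_step_of_lt {τ : S.Side → S.Side} {h : S.Side} {a i : ℕ} (hi : i < a) :
    sideSeq τ h a i = τ (sideSeq τ h a (i + 1)) := by
  rw [sideSeq_of_le hi.le, sideSeq_of_le hi, ← Function.iterate_succ_apply' τ]
  congr 2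
  omega

lemma sideSeq_step_of_ge {τ : S.Side → S.Side} {h : S.Side} {a i : ℕ} (hi : a ≤ i) :
    flip (sideSeq τ h a (i + 1)) = τ (flip (sideSeq τ h a i)) := by
  rw [sideSeq_of_ge hi, sideSeq_of_ge (by omega), flip_flip_side, flip_flip_side,
    ← Function.iterate_succ_apply' τ]
  congr 2
  omega

/-- The sequence of points on the right of a curve which keeps turning right is constant. -/
lemma sidePoint_one_eq {G : ℕ → S.Side} {a b : ℕ}
    (hG : ∀ i, a ≤ i → i < b → HasNext (G (i + 1)) ∧ flip (G i) = next (G (i + 1))) (i : ℕ)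
    (h1 : a ≤ i) (h2 : i ≤ b) : sidePoint (G i) 1 = sidePoint (G a) 1 := by
  induction i, h1 using Nat.le_induction with
  | base => rfl
  | succ i hi ih =>
    obtain ⟨h, e⟩ := hG i hi h2
    rw [← ih (by omega), ← sidePoint_next _ h, ← e, ← sidePoint_flip (G i) 1, unitInterval.symm_one]

/-- The sequence of points on the left of a curve which keeps turning left is constant. -/
lemma sidePoint_zero_eq {G : ℕ → S.Side} {a b : ℕ}
    (hG : ∀ i, a ≤ i → i < b → HasNext (flip (G i)) ∧ G (i + 1) = next (flip (G i))) (i : ℕ)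
    (h1 : a ≤ i) (h2 : i ≤ b) : sidePoint (G i) 0 = sidePoint (G a) 0 := by
  induction i, h1 using Nat.le_induction with
  | base => rfl
  | succ i hi ih =>
    obtain ⟨h, e⟩ := hG i hi h2
    rw [← ih (by omega), e, sidePoint_next _ h, ← sidePoint_flip (G i) 0, unitInterval.symm_zero]

/-- Every arc has a projective permissible curve. -/
theorem exists_isProjective (γ : S.Arc) : ∃ c : S.PermissibleCurve, c.IsProjective γ := by
  classical
  obtain ⟨h, rfl⟩ : ∃ h : S.Side, arcOf h = γ :=
    ⟨S.glue.symm (γ, true), congrArg Prod.fst (S.glue.apply_symm_apply _)⟩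
  set τ : S.Side → S.Side := fun x => flip (next x) with hτ
  have Ha : ∃ a, ¬ HasNext (τ^[a] (flip h)) := S.marked_boundary _
  have Hb : ∃ b, ¬ HasNext (τ^[b] h) := S.marked_boundary _
  -- `a` and `b` are the numbers of turns available about the two ends of the arc before the
  -- boundary. The first sequence is traversed backwards, so the curve turns right `a` times,
  -- crosses the arc at index `a`, and turns left `b` times.
  obtain ⟨a, ha, ha'⟩ : ∃ a, ¬ HasNext (τ^[a] (flip h)) ∧ ∀ i < a, HasNext (τ^[i] (flip h)) :=
    ⟨_, Nat.find_spec Ha, fun i hi => not_not.1 (Nat.find_min Ha hi)⟩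
  obtain ⟨b, hb, hb'⟩ : ∃ b, ¬ HasNext (τ^[b] h) ∧ ∀ i < b, HasNext (τ^[i] h) :=
    ⟨_, Nat.find_spec Hb, fun i hi => not_not.1 (Nat.find_min Hb hi)⟩
  let G := sideSeq τ h a
  have hright : ∀ i, i < a → HasNext (G (i + 1)) ∧ flip (G i) = next (G (i + 1)) := by
    intro i hi
    constructor
    · rw [show G (i + 1) = _ from sideSeq_of_le hi]
      exact ha' _ (by omega)
    · rw [show G i = _ from sideSeq_step_of_lt hi, hτ, flip_flip_side]
  have hleft : ∀ i, a ≤ i → i < a + b → HasNext (flip (G i)) ∧ G (i + 1) = next (flip (G i)) := by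
    intro i hi hib
    constructor
    · rw [show G i = _ from sideSeq_of_ge hi, flip_flip_side]
      exact hb' _ (by omega)
    · rw [← flip_flip_side (G (i + 1)), show flip (G (i + 1)) = _ from sideSeq_step_of_ge hi, hτ,
        flip_flip_side]
  obtain ⟨c, hn, hG, hL, hR⟩ := exists_permissibleCurve (a + b) G (fun i => a < i)
    (fun i hi h => hleft i (by omega) hi) (fun i hi h => hright i (by omega))
  refine ⟨c, a, by omega, ?_, ⟨sidePoint (G 0) 1, fun i h1 h2 => ?_⟩,
    ⟨sidePoint (G a) 0, fun i h1 h2 => ?_⟩, ?_, ?_⟩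
  · rw [PermissibleCurve.arc, hG a (by omega), show G a = _ from sideSeq_of_le le_rfl,
      Nat.sub_self]
    exact arcOf_flip h
  · obtain ⟨i, rfl⟩ := Nat.exists_eq_add_of_le' h1
    rw [← sidePoint_one_eq (fun i _ hi => hright i hi) (i + 1) (Nat.zero_le _) h2]
    exact hR i (by omega) (by omega)
  · obtain ⟨i, rfl⟩ := Nat.exists_eq_add_of_le' (show 1 ≤ i by omega)
    rw [← sidePoint_zero_eq hleft (i + 1) (by omega) (by omega)]
    exact hL i (by omega) (by omega)
  · rw [hG 0 (by omega), show G 0 = _ from sideSeq_of_le (Nat.zero_le _)]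
    exact ha
  · rw [c.cross c.n le_rfl, hn, hG _ le_rfl, show G (a + b) = _ from sideSeq_of_ge (by omega),
      flip_flip_side, Nat.add_sub_cancel_left]
    exact hb

/-- Every arc has an injective permissible curve. -/
theorem exists_isInjective (γ : S.Arc) : ∃ c : S.PermissibleCurve, c.IsInjective γ := by
  classical
  obtain ⟨h, rfl⟩ : ∃ h : S.Side, arcOf h = γ :=
    ⟨S.glue.symm (γ, true), congrArg Prod.fst (S.glue.apply_symm_apply _)⟩
  set τ : S.Side → S.Side := fun x => flip (prev x) with hτ
  have Ha : ∃ a, ¬ HasPrev (τ^[a] (flip h)) := exists_not_hasPrev _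
  have Hb : ∃ b, ¬ HasPrev (τ^[b] h) := exists_not_hasPrev _
  obtain ⟨a, ha, ha'⟩ : ∃ a, ¬ HasPrev (τ^[a] (flip h)) ∧ ∀ i < a, HasPrev (τ^[i] (flip h)) :=
    ⟨_, Nat.find_spec Ha, fun i hi => not_not.1 (Nat.find_min Ha hi)⟩
  obtain ⟨b, hb, hb'⟩ : ∃ b, ¬ HasPrev (τ^[b] h) ∧ ∀ i < b, HasPrev (τ^[i] h) :=
    ⟨_, Nat.find_spec Hb, fun i hi => not_not.1 (Nat.find_min Hb hi)⟩
  let G := sideSeq τ h a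
  have hleft : ∀ i, i < a → HasNext (flip (G i)) ∧ G (i + 1) = next (flip (G i)) := by
    intro i hi
    -- With `prev` in place of `next` the turning is clockwise, so the part traversed backwards now
    -- consists of left turns and the part after the arc of right turns.
    rw [show G i = _ from sideSeq_step_of_lt hi, hτ, flip_flip_side, hasNext_prev_iff, next_prev]
    refine ⟨?_, rfl⟩
    rw [sideSeq_of_le hi]
    exact ha' _ (by omega)
  have hright : ∀ i, a ≤ i → i < a + b → HasNext (G (i + 1)) ∧ flip (G i) = next (G (i + 1)) := by
    intro i hi hib
    rw [← flip_flip_side (G (i + 1)), show flip (G (i + 1)) = _ from sideSeq_step_of_ge hi, hτ,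
      flip_flip_side, hasNext_prev_iff, next_prev]
    refine ⟨?_, rfl⟩
    rw [sideSeq_of_ge hi, flip_flip_side]
    exact hb' _ (by omega)
  obtain ⟨c, hn, hG, hL, hR⟩ := exists_permissibleCurve (a + b) G (fun i => i ≤ a)
    (fun i hi h => hleft i h) (fun i hi h => hright i (by omega) hi)
  refine ⟨c, a, by omega, ?_, ⟨sidePoint (G 0) 0, fun i h1 h2 => ?_⟩,
    ⟨sidePoint (G a) 1, fun i h1 h2 => ?_⟩, ?_, ?_⟩
  · rw [PermissibleCurve.arc, hG a (by omega), show G a = _ from sideSeq_of_le le_rfl,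
      Nat.sub_self]
    exact arcOf_flip h
  · obtain ⟨i, rfl⟩ := Nat.exists_eq_add_of_le' h1
    rw [← sidePoint_zero_eq (fun i _ hi => hleft i hi) (i + 1) (Nat.zero_le _) h2]
    exact hL i (by omega) h2
  · obtain ⟨i, rfl⟩ := Nat.exists_eq_add_of_le' (show 1 ≤ i by omega)
    rw [← sidePoint_one_eq hright (i + 1) (by omega) (by omega)]
    exact hR i (by omega) (by omega)
  · rw [hG 0 (by omega), show G 0 = _ from sideSeq_of_le (Nat.zero_le _)]
    exact ha
  · rw [c.cross c.n le_rfl, hn, hG _ le_rfl, show G (a + b) = _ from sideSeq_of_ge (by omega),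
      flip_flip_side, Nat.add_sub_cancel_left]
    exact hb

end Existence

end MarkedRibbonSurface

/-! ### Projective covers and injective envelopes from permissible curves -/

theorem mainTheorem9 (k : Type*) [Field k] (S : MarkedRibbonSurface) :
    -- every arc has a projective and an injective permissible curve
    (∀ γ : S.Arc, (∃ p : S.PermissibleCurve, p.IsProjective γ) ∧
      ∃ q : S.PermissibleCurve, q.IsInjective γ) ∧
    -- and for every choice of such curves:
    ∀ proj inj : S.Arc → S.PermissibleCurve,
      (∀ γ, (proj γ).IsProjective γ) → (∀ γ, (inj γ).IsInjective γ) →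
      -- string modules
      (∀ c : S.PermissibleCurve,
        IsProjectiveCover (S.Alg k)ᵐᵒᵖ
          (DirectSum c.TopIndex fun i => (proj (c.arc i.1)).Mod k) (c.Mod k) ∧
        IsInjectiveEnvelope (S.Alg k)ᵐᵒᵖ
          (DirectSum c.SocIndex fun i => (inj (c.arc i.1)).Mod k) (c.Mod k)) ∧
      -- band modules
      (∀ (c : S.PermissibleClosedCurve) (V : Type*) [AddCommGroup V] [Module k V]
          [FiniteDimensional k V] (φ : V ≃ₗ[k] V),
        IsProjectiveCover (S.Alg k)ᵐᵒᵖ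
          (DirectSum c.TopIndex fun i =>
            Fin (Module.finrank k V) → (proj (c.arc i.1)).Mod k) (c.Mod k V φ) ∧
        IsInjectiveEnvelope (S.Alg k)ᵐᵒᵖ
          (DirectSum c.SocIndex fun i =>
            Fin (Module.finrank k V) → (inj (c.arc i.1)).Mod k) (c.Mod k V φ)) := by

  refine ⟨fun γ => ⟨S.exists_isProjective γ, S.exists_isInjective γ⟩,
    fun proj inj hproj hinj => ⟨fun c => ?_, fun c V _ _ _ φ => ?_⟩⟩
  · exact ⟨c.isProjectiveCover k hproj, c.isInjectiveEnvelope k hinj⟩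
  · exact ⟨c.isProjectiveCover φ hproj, c.isInjectiveEnvelope φ hinj⟩
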